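/- Let $\varepsilon_1,\dots,\varepsilon_8$ be the standard basis of $\mathbb{R}^8$ with the standard inner product $(\cdot,\cdot)$, put $\langle v,w\rangle = 2(v,w)/(w,w)$, and let $\mathbb{E}\subset\mathbb{R}^8$ be the subspace orthogonal to $\varepsilon_6-\varepsilon_7$ and $\varepsilon_7+\varepsilon_8$. Let $\Phi\subset\mathbb{E}$ be the root system of type $\mathrm{E}_6$, consisting of the vectors $\pm\varepsilon_i\pm\varepsilon_j$ ($1\le i<j\le 5$) and $\pm\tfrac12\bigl(\varepsilon_8-\varepsilon_7-\varepsilon_6+\sum_{i=1}^5(-1)^{\nu(i)}\varepsilon_i\bigr)$ with $\nu(i)\in\{0,1\}$ and $\sum_i\nu(i)$ even, with base $$\alpha_1=\tfrac12(\varepsilon_1+\varepsilon_8)-\tfrac12(\varepsilon_2+\dots+\varepsilon_7),\quad \alpha_2=\varepsilon_1+\varepsilon_2,\quad \alpha_i=\varepsilon_{i-1}-\varepsilon_{i-2}\ (3\le i\le 6).$$ Let $E_6=\mathbb{Z}\Phi$ be the root lattice, $\mathcal{W}$ the Weyl group (generated by the reflections in the roots), and, with $\gamma=\varepsilon_8-\varepsilon_7-\varepsilon_6$,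 put $$\varpi_1=\tfrac23\gamma,\quad \varpi_2=\tfrac12(\varepsilon_1+\dots+\varepsilon_5+\gamma),\quad \varpi_3=\tfrac56\gamma+\tfrac12(-\varepsilon_1+\varepsilon_2+\dots+\varepsilon_5),$$ $$\varpi_4=\varepsilon_3+\varepsilon_4+\varepsilon_5+\gamma,\quad \varpi_5=\tfrac23\gamma+\varepsilon_4+\varepsilon_5,\quad \varpi_6=\tfrac13\gamma+\varepsilon_5 .$$ Write $\mathbb{Z}_+=\{0,1,2,\dots\}$, $\Lambda_+=\sum_{i=1}^6\mathbb{Z}_+\varpi_i$ and $M=\Lambda_+\cap E_6$. Let $\mathbf{x}^v$ be the basis element of a group algebra that corresponds to $v$, let $\mathcal{O}(v)=\sum_{u\in\mathcal{W}v}\mathbf{x}^u$ be the orbit sum of $v$, and let $\mathbb{Z}[E_6]^{\mathcal{W}}$ be the algebra of $\mathcal{W}$-invariants of the group algebra $\mathbb{Z}[E_6]$. The Hilbert basis of a monoid without units other than $0$ is the set of its indecomposable elements, when this set is finite and generates the monoid. Then the following hold. 1. The group $\mathcal{W}$ is finite, and $\varpi_1,\dots,\varpi_6$ are the fundamental weights: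 $\varpi_i\in\mathbb{E}$ and $\langle\varpi_i,\alpha_j\rangle=\delta_{ij}$. 2. There is an isomorphism of algebras $\Omega:\mathbb{Z}[M]\to\mathbb{Z}[E_6]^{\mathcal{W}}$ that sends the basis element $\sum_i l_i\varpi_i\in M$ ($l_i\in\mathbb{Z}_+$) to $\prod_{i=1}^6\mathcal{O}(\varpi_i)^{l_i}$. 3. The map $(l_1,\dots,l_6)\mapsto\sum_i l_i\varpi_i$ is an isomorphism of monoids $$\{l\in\mathbb{Z}_+^6 \mid l_1+2l_3+l_5+2l_6\equiv 0 \bmod 3\}\;\cong\; M,$$ and $((a,b),k)\mapsto(k_1,a,k_2,b,k_3,k_4)$ is an isomorphism from $\mathbb{Z}_+^2\oplus W$ to the left-hand side, where $W=\{k\in\mathbb{Z}_+^4\mid k_1+2k_2+k_3+2k_4\equiv0\bmod 3\}$. 4. The Hilbert basis of $W$ consists of the twelve distinct elements $$\begin{aligned}&m_1=(3,0,0,0),\ m_2=(0,3,0,0),\ m_3=(0,0,3,0),\ m_4=(0,0,0,3),\\ &m_5=(1,1,0,0),\ m_6=(1,0,0,1),\ m_7=(0,1,1,0),\ m_8=(0,0,1,1),\\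 &m_9=(1,0,2,0),\ m_{10}=(0,1,0,2),\ m_{11}=(0,2,0,1),\ m_{12}=(2,0,1,0),\end{aligned}$$ and the Hilbert basis of $M$ consists of the fourteen distinct elements $\varpi_2$, $\varpi_4$ and $k_1\varpi_1+k_2\varpi_3+k_3\varpi_5+k_4\varpi_6$ with $k\in\{m_1,\dots,m_{12}\}$. 5. The algebra $\mathbb{Z}[E_6]^{\mathcal{W}}$ is generated by $\mathcal{O}(\varpi_2)$, $\mathcal{O}(\varpi_4)$ and the twelve products $$\theta_j=\mathcal{O}(\varpi_1)^{k_1}\mathcal{O}(\varpi_3)^{k_2}\mathcal{O}(\varpi_5)^{k_3}\mathcal{O}(\varpi_6)^{k_4},\qquad (k_1,k_2,k_3,k_4)=m_j,\quad 1\le j\le 12,$$ and $\mathcal{O}(\varpi_2),\mathcal{O}(\varpi_4)$ are algebraically independent over $\mathbb{Z}[\theta_1,\dots,\theta_{12}]$. 6. The kernel of $\mathbb{Z}[x_1,\dots,x_{12}]\to\mathbb{Z}[E_6]^{\mathcal{W}}$, $x_j\mapsto\theta_j$, is generated by the following 35 binomials, and these also generate the kernel of the surjection $\mathbb{Z}[t_1,t_2,x_1,\dots,x_{12}]\to\mathbb{Z}[E_6]^{\mathcal{W}}$,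 $t_1\mapsto\mathcal{O}(\varpi_2)$, $t_2\mapsto\mathcal{O}(\varpi_4)$, $x_j\mapsto\theta_j$: $$\begin{aligned} &x_7x_{10}-x_8x_{11},\ x_6x_9-x_8x_{12},\ x_5x_{10}-x_6x_{11},\ x_5x_9-x_7x_{12},\ x_5x_8-x_6x_7,\\ &x_6x_7x_8-x_9x_{10},\ x_6x_7^2-x_9x_{11},\ x_6^2x_7-x_{10}x_{12},\ x_5x_6x_7-x_{11}x_{12},\ x_4x_{12}-x_6^2x_8,\\ &x_4x_{11}-x_{10}^2,\ x_4x_9-x_6x_8^2,\ x_4x_7-x_8x_{10},\ x_4x_5-x_6x_{10},\ x_3x_{12}-x_9^2,\\ &x_3x_{11}-x_7^2x_8,\ x_3x_{10}-x_7x_8^2,\ x_3x_6-x_8x_9,\ x_3x_5-x_7x_9,\ x_3x_4-x_8^3,\\ &x_2x_{12}-x_5^2x_7,\ x_2x_{10}-x_{11}^2,\ x_2x_9-x_5x_7^2,\ x_2x_8-x_7x_{11},\ x_2x_6-x_5x_{11},\\ &x_2x_4-x_{10}x_{11},\ x_2x_3-x_7^3,\ x_1x_{11}-x_5^2x_6,\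 x_1x_{10}-x_5x_6^2,\ x_1x_9-x_{12}^2,\\ &x_1x_8-x_6x_{12},\ x_1x_7-x_5x_{12},\ x_1x_4-x_6^3,\ x_1x_3-x_9x_{12},\ x_1x_2-x_5^3. \end{aligned}$$ -/

import Mathlib

noncomputable section

namespace RootE6

/-- The ambient Euclidean space `ℝ⁸`, coordinates numbered `0, …, 7`. -/
abbrev V : Type := EuclideanSpace ℝ (Fin 8)

/-- The standard basis vectors of `ℝ⁸` (`e i` is the basis vector usually called `ε_{i+1}`). -/
def e (i : Fin 8) : V := EuclideanSpace.single i 1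

/-- The 6-dimensional space of the root system: the vectors of `ℝ⁸` that are orthogonal to
`ε₆ - ε₇` and to `ε₇ + ε₈`. -/
def E : Submodule ℝ V := (Submodule.span ℝ {e 5 - e 6, e 6 + e 7})ᗮ

/-- The bracket `⟨v, w⟩ = 2 (v, w) / (w, w)`. -/
def bracket (v w : V) : ℝ := 2 * inner ℝ v w / inner ℝ w w

/-- The roots `± ε_i ± ε_j` for `i < j ≤ 5`. -/
def rootsD : Set V :=
  {v | ∃ i j : Fin 5, i < j ∧ ∃ s t : ℝ, (s = 1 ∨ s = -1) ∧ (t = 1 ∨ t = -1) ∧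
    v = s • e (i.castLE (by norm_num)) + t • e (j.castLE (by norm_num))}

/-- The roots `± ½ (ε₈ - ε₇ - ε₆ + ∑_{i ≤ 5} (-1)^{ν(i)} ε_i)` with `∑ ν(i)` even. -/
def rootsSpin : Set V :=
  {v | ∃ ν : Fin 5 → Fin 2, Even (∑ i, (ν i : ℕ)) ∧ ∃ s : ℝ, (s = 1 ∨ s = -1) ∧
    v = s • ((1 / 2 : ℝ) •
      (e 7 - e 6 - e 5 + ∑ i : Fin 5, ((-1 : ℝ) ^ (ν i : ℕ)) • e (i.castLE (by norm_num))))}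

/-- The root system of type `E₆`. -/
def roots : Set V := rootsD ∪ rootsSpin

/-- The base `α₁, …, α₆` (`simpleRoot i` is `α_{i+1}`). -/
def simpleRoot : Fin 6 → V :=
  ![(1 / 2 : ℝ) • (e 0 + e 7) - (1 / 2 : ℝ) • (e 1 + e 2 + e 3 + e 4 + e 5 + e 6),
    e 0 + e 1,
    e 1 - e 0,
    e 2 - e 1,
    e 3 - e 2,
    e 4 - e 3]

/-- The fundamental weights `ϖ₁, …, ϖ₆` (`weight i` is `ϖ_{i+1}`). -/
def weight : Fin 6 → V :=
  ![(2 / 3 : ℝ) • (e 7 - e 6 - e 5),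
    (1 / 2 : ℝ) • (e 0 + e 1 + e 2 + e 3 + e 4 - e 5 - e 6 + e 7),
    (5 / 6 : ℝ) • (e 7 - e 6 - e 5) + (1 / 2 : ℝ) • (-e 0 + e 1 + e 2 + e 3 + e 4),
    e 2 + e 3 + e 4 - e 5 - e 6 + e 7,
    (2 / 3 : ℝ) • (e 7 - e 6 - e 5) + e 3 + e 4,
    (1 / 3 : ℝ) • (e 7 - e 6 - e 5) + e 4]

/-- The root lattice: the additive group generated by the roots. -/
def rootLattice : AddSubgroup V := AddSubgroup.closure roots

/-- The monoid `Λ₊` of dominant weights, generated by the fundamental weights. -/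
def dominantWeights : AddSubmonoid V := AddSubmonoid.closure (Set.range weight)

/-- The monoid `M = Λ₊ ∩ L`, where `L` is the root lattice. -/
def M : AddSubmonoid V := dominantWeights ⊓ rootLattice.toAddSubmonoid

/-- The Weyl group: the group generated by the reflections in the hyperplanes orthogonal to the
roots. (It acts on all of `ℝ⁸`, trivially on the orthogonal complement of `E`.) -/
def weylGroup : Subgroup (V ≃ₗᵢ[ℝ] V) :=
  Subgroup.closure {g | ∃ α ∈ roots, g = (Submodule.span ℝ {α})ᗮ.reflection}

/-- The group algebra `ℤ[V]` of the additive group of `ℝ⁸`. It contains the group algebras of the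
root lattice and of the weight lattice. -/
abbrev GroupAlg : Type := AddMonoidAlgebra ℤ V

/-- The Weyl group orbit of a vector. -/
def weylOrbit (v : V) : Set V := {u | ∃ w ∈ weylGroup, w v = u}

/-- The orbit sum `∑ x^u`, with `u` running through the Weyl group orbit of `v`. -/
def orbitSum (v : V) : GroupAlg :=
  ∑ᶠ u ∈ weylOrbit v, AddMonoidAlgebra.single u (1 : ℤ)

/-- The group algebra `ℤ[L]` of the root lattice, as a subalgebra of `ℤ[V]`. -/
def rootLatticeAlg : Subalgebra ℤ GroupAlg :=
  (AddMonoidAlgebra.mapDomainAlgHom ℤ ℤ rootLattice.subtype).range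

/-- The elements of `ℤ[V]` that are fixed by the map `x^v ↦ x^{w(v)}` for all `w` in the
Weyl group. -/
def fixedAlg : Subalgebra ℤ GroupAlg :=
  ⨅ w ∈ weylGroup, AlgHom.equalizer
    (AddMonoidAlgebra.mapDomainAlgHom ℤ ℤ (w.toLinearEquiv.toAddEquiv : V →+ V))
    (AlgHom.id ℤ GroupAlg)

/-- The multiplicative invariant algebra `ℤ[L]^𝒲` of the root lattice. -/
def invariantAlg : Subalgebra ℤ GroupAlg := rootLatticeAlg ⊓ fixedAlg

/-- The monoid of all `l ∈ ℕ⁶` with `l₁ + 2 l₃ + l₅ + 2 l₆ ≡ 0 mod 3`. -/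
def coordMonoid : AddSubmonoid (Fin 6 → ℕ) where
  carrier := {l | 3 ∣ l 0 + 2 * l 2 + l 4 + 2 * l 5}
  zero_mem' := by simp
  add_mem' := by
    intro a b ha hb
    simp only [Set.mem_ofPred_eq, Pi.add_apply] at *
    omega

/-- The monoid `W` of all `k ∈ ℕ⁴` with `k₁ + 2 k₂ + k₃ + 2 k₄ ≡ 0 mod 3`. -/
def W : AddSubmonoid (Fin 4 → ℕ) where
  carrier := {k | 3 ∣ k 0 + 2 * k 1 + k 2 + 2 * k 3}
  zero_mem' := by simp
  add_mem' := by
    intro a b ha hb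
    simp only [Set.mem_ofPred_eq, Pi.add_apply] at *
    omega

/-- `H` is the Hilbert basis of the monoid `N`: the monoid `N` is positive (`0` is its only
invertible element), `H` is finite, `H` generates `N`, and `H` is the set of all indecomposable
elements of `N`. -/
structure IsHilbertBasis {A : Type*} [AddCommMonoid A] (N : AddSubmonoid A) (H : Set A) :
    Prop where
  positive : ∀ a ∈ N, ∀ b ∈ N, a + b = 0 → a = 0
  finite : H.Finite
  closure_eq : AddSubmonoid.closure H = N
  eq_indecomposables :
    H = {m | m ∈ N ∧ m ≠ 0 ∧ ∀ a ∈ N, ∀ b ∈ N, m = a + b → a = 0 ∨ b = 0}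

/-- The twelve elements `m₁, …, m₁₂` of `W`. -/
def hilbW : Fin 12 → (Fin 4 → ℕ) :=
  ![![3, 0, 0, 0], ![0, 3, 0, 0], ![0, 0, 3, 0], ![0, 0, 0, 3],
    ![1, 1, 0, 0], ![1, 0, 0, 1], ![0, 1, 1, 0], ![0, 0, 1, 1],
    ![1, 0, 2, 0], ![0, 1, 0, 2], ![0, 2, 0, 1], ![2, 0, 1, 0]]

/-- The coordinate vector `(k₁, a, k₂, b, k₃, k₄)`. -/
def insertCoords (a b : ℕ) (k : Fin 4 → ℕ) : Fin 6 → ℕ := ![k 0, a, k 1, b, k 2, k 3]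

/-- The fourteen elements `ϖ₂`, `ϖ₄` and `k₁ ϖ₁ + k₂ ϖ₃ + k₃ ϖ₅ + k₄ ϖ₆`, for `k` one of the
twelve elements of `W` above. -/
def hilbM : Fin 2 ⊕ Fin 12 → V :=
  Sum.elim ![weight 1, weight 3]
    (fun j => ∑ i, insertCoords 0 0 (hilbW j) i • weight i)

/-- The twelve products of orbit sums
`O(ϖ₁)^{k₁} O(ϖ₃)^{k₂} O(ϖ₅)^{k₃} O(ϖ₆)^{k₄}`, for `k` one of the twelve elements of `W` above. -/
def prodInv (j : Fin 12) : GroupAlg :=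
  orbitSum (weight 0) ^ hilbW j 0 * orbitSum (weight 2) ^ hilbW j 1 *
    orbitSum (weight 4) ^ hilbW j 2 * orbitSum (weight 5) ^ hilbW j 3

/-- The two orbit sums `O(ϖ₂)` and `O(ϖ₄)`. -/
def freeInv : Fin 2 → GroupAlg := ![orbitSum (weight 1), orbitSum (weight 3)]

/-- The fourteen fundamental invariants. -/
def fundInv : Fin 2 ⊕ Fin 12 → GroupAlg := Sum.elim freeInv prodInv

/-- The 35 binomials in elements `x₁, …, x₁₂` of a commutative ring. -/
def relations {R : Type*} [CommRing R] (x : Fin 12 → R) : Fin 35 → R :=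
  let x1 := x 0
  let x2 := x 1
  let x3 := x 2
  let x4 := x 3
  let x5 := x 4
  let x6 := x 5
  let x7 := x 6
  let x8 := x 7
  let x9 := x 8
  let x10 := x 9
  let x11 := x 10
  let x12 := x 11
  ![x7 * x10 - x8 * x11,
    x6 * x9 - x8 * x12,
    x5 * x10 - x6 * x11,
    x5 * x9 - x7 * x12,
    x5 * x8 - x6 * x7,
    x6 * x7 * x8 - x9 * x10,
    x6 * x7 ^ 2 - x9 * x11,
    x6 ^ 2 * x7 - x10 * x12,
    x5 * x6 * x7 - x11 * x12,
    x4 * x12 - x6 ^ 2 * x8,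
    x4 * x11 - x10 ^ 2,
    x4 * x9 - x6 * x8 ^ 2,
    x4 * x7 - x8 * x10,
    x4 * x5 - x6 * x10,
    x3 * x12 - x9 ^ 2,
    x3 * x11 - x7 ^ 2 * x8,
    x3 * x10 - x7 * x8 ^ 2,
    x3 * x6 - x8 * x9,
    x3 * x5 - x7 * x9,
    x3 * x4 - x8 ^ 3,
    x2 * x12 - x5 ^ 2 * x7,
    x2 * x10 - x11 ^ 2,
    x2 * x9 - x5 * x7 ^ 2,
    x2 * x8 - x7 * x11,
    x2 * x6 - x5 * x11,
    x2 * x4 - x10 * x11,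
    x2 * x3 - x7 ^ 3,
    x1 * x11 - x5 ^ 2 * x6,
    x1 * x10 - x5 * x6 ^ 2,
    x1 * x9 - x12 ^ 2,
    x1 * x8 - x6 * x12,
    x1 * x7 - x5 * x12,
    x1 * x4 - x6 ^ 3,
    x1 * x3 - x9 * x12,
    x1 * x2 - x5 ^ 3]

end RootE6

end

/-! The height of a vector is its pairing with the sum `rho` of the fundamental weights. In the Weyl
orbit of ϖ_i the vector ϖ_i alone has maximal height (`weylOrbit_weight`). Hence ∏ O(ϖ_i)^{l_i} has
leading term x^v with v = ∑ l_i ϖ_i, and its other exponents are lower and congruent to v modulo the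
root lattice. Distinct l have distinct leading exponents, so these products are linearly independent
(`linearIndependent_orbitMonomial`). Conversely, an exponent of maximal height in an invariant is
dominant, since otherwise a simple reflection would raise it; subtracting products with the same
leading terms lowers the height (`mem_span_of_height_lt`). So the products with v in the root
lattice form a ℤ-basis of the invariant algebra, and they multiply like the elements of M. This is
Ω.

An integral weight lies in the root lattice exactly when its labels satisfy one congruence mod 3
(`mem_rootLattice`). The labels of ϖ₂ and ϖ₄ do not enter it, so M splits as ℕ² ⊕ W. The Hilbert
bases consist of the minimal nonzero elements, found by a finite check because a coordinate ≥ 3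
already dominates one of m₁, …, m₄.

For the relations, monomials in the generators map to basis elements indexed by their degree, so the
kernel is generated by differences of monomials of equal degree (`ker_eq_of_linearIndependent`). It
remains to show that such monomials agree in every commutative ring where the 35 binomials vanish
(`prod_eq_of_multiDeg_eq`); this is applied to the quotient by the ideal of the binomials. The
argument factors out one generator x_j at a time. As x_j has total degree at most 3, at most three
factors of the monomial are needed to cover it, and these cases are a finite check (`cub_exists`).
-/

namespace RootE6

/-! ### Monomials in the twelve generators -/

/-- The degrees of `x₁, …, x₁₂` in `ℕ⁴`, followed by the degree `0` of the element `1`. -/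
def genDeg : Fin 13 → Fin 4 → ℕ :=
  ![![3, 0, 0, 0], ![0, 3, 0, 0], ![0, 0, 3, 0], ![0, 0, 0, 3],
    ![1, 1, 0, 0], ![1, 0, 0, 1], ![0, 1, 1, 0], ![0, 0, 1, 1],
    ![1, 0, 2, 0], ![0, 1, 0, 2], ![0, 2, 0, 1], ![2, 0, 1, 0], ![0, 0, 0, 0]]

theorem genDeg_castSucc : ∀ j : Fin 12, genDeg j.castSucc = hilbW j := by decide

theorem genDeg_last : genDeg 12 = 0 := by decide

/-- `x_p x_q` and `x_r x_s` have the same degree. -/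
abbrev QuadEq (p q r s : Fin 13) : Prop :=
  genDeg p 0 + genDeg q 0 = genDeg r 0 + genDeg s 0 ∧
  genDeg p 1 + genDeg q 1 = genDeg r 1 + genDeg s 1 ∧
  genDeg p 2 + genDeg q 2 = genDeg r 2 + genDeg s 2 ∧
  genDeg p 3 + genDeg q 3 = genDeg r 3 + genDeg s 3

/-- `x_p x_q x_r` and `x_s x_t` have the same degree. -/
abbrev CubEq (p q r s t : Fin 13) : Prop :=
  genDeg p 0 + genDeg q 0 + genDeg r 0 = genDeg s 0 + genDeg t 0 ∧
  genDeg p 1 + genDeg q 1 + genDeg r 1 = genDeg s 1 + genDeg t 1 ∧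
  genDeg p 2 + genDeg q 2 + genDeg r 2 = genDeg s 2 + genDeg t 2 ∧
  genDeg p 3 + genDeg q 3 + genDeg r 3 = genDeg s 3 + genDeg t 3

/-- The generator is one of `x₅, …, x₈`. -/
abbrev IsMixed (p : Fin 13) : Prop := 4 ≤ p ∧ p ≤ 7

/-- `x_j` divides `x_p x_q` in degrees. -/
abbrev QuadLe (j : Fin 12) (p q : Fin 13) : Prop :=
  hilbW j 0 ≤ genDeg p 0 + genDeg q 0 ∧ hilbW j 1 ≤ genDeg p 1 + genDeg q 1 ∧
  hilbW j 2 ≤ genDeg p 2 + genDeg q 2 ∧ hilbW j 3 ≤ genDeg p 3 + genDeg q 3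

/-- `x_j` divides `x_p x_q x_r` in degrees. -/
abbrev CubLe (j : Fin 12) (p q r : Fin 13) : Prop :=
  hilbW j 0 ≤ genDeg p 0 + genDeg q 0 + genDeg r 0 ∧
  hilbW j 1 ≤ genDeg p 1 + genDeg q 1 + genDeg r 1 ∧
  hilbW j 2 ≤ genDeg p 2 + genDeg q 2 + genDeg r 2 ∧
  hilbW j 3 ≤ genDeg p 3 + genDeg q 3 + genDeg r 3

/-- The pairs of distinct quadratic monomials of equal degree. -/
def quadTable : List (Fin 13 × Fin 13 × Fin 13 × Fin 13) :=
  [(6, 9, 7, 10), (5, 8, 7, 11), (4, 9, 5, 10), (4, 8, 6, 11), (4, 7, 5, 6), (3, 10, 9, 9),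
    (3, 6, 7, 9), (3, 4, 5, 9), (2, 11, 8, 8), (2, 5, 7, 8), (2, 4, 6, 8), (1, 9, 10, 10),
    (1, 7, 6, 10), (1, 5, 4, 10), (1, 3, 9, 10), (0, 8, 11, 11), (0, 7, 5, 11), (0, 6, 4, 11),
    (0, 2, 8, 11)]

/-- The cubic monomials in `x₅, …, x₈` and the quadratic monomials of the same degree. -/
def cubTable : List (Fin 13 × Fin 13 × Fin 13 × Fin 13 × Fin 13) :=
  [(5, 6, 7, 8, 9), (5, 6, 6, 8, 10), (5, 5, 6, 9, 11), (4, 5, 6, 10, 11), (5, 5, 7, 3, 11),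
    (5, 7, 7, 3, 8), (6, 6, 7, 2, 10), (6, 7, 7, 2, 9), (7, 7, 7, 2, 3), (4, 4, 6, 1, 11),
    (4, 6, 6, 1, 8), (6, 6, 6, 1, 2), (4, 4, 5, 0, 10), (4, 5, 5, 0, 9), (5, 5, 5, 0, 3),
    (4, 4, 4, 0, 1), (4, 4, 7, 10, 11), (4, 7, 7, 8, 9), (4, 5, 7, 9, 11), (4, 6, 7, 8, 10)]

/-- Exhaustive check that the table is complete. Index 12 stands for the factor 1, so products with
fewer than two generators are covered as well. -/
theorem quadEq_mem_table : ∀ p q r s : Fin 13, QuadEq p q r s → p ≤ q → r ≤ s →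
    (p = r ∧ q = s) ∨ (p, q, r, s) ∈ quadTable ∨ (r, s, p, q) ∈ quadTable := by
  decide +kernel

/-- The generators x₅, …, x₈ have total degree 2 and the others 3, so three mixed factors can
balance exactly two unmixed ones. -/
theorem cubEq_mem_table : ∀ p q r : Fin 13, IsMixed p → IsMixed q → IsMixed r → p ≤ q → q ≤ r →
    ∀ s t, s ≤ t → CubEq p q r s t → (p, q, r, s, t) ∈ cubTable := by
  decide +kernel

/-- The second alternative is for a mixed x_j hidden in a product of two generators of total degree
3, such as x₆ in x₄x₁₂ = x₆²x₈. -/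
theorem quad_exists : ∀ (j : Fin 12) (p q : Fin 13), QuadLe j p q →
    (∃ s, QuadEq p q j.castSucc s) ∨
      ∃ s t, IsMixed j.castSucc ∧ IsMixed s ∧ IsMixed t ∧ CubEq j.castSucc s t p q := by
  decide +kernel

/-- In the last three alternatives a quadratic relation rewrites two of the factors, after which x_j
divides a product of only two. -/
theorem cub_exists : ∀ (j : Fin 12) (p q r : Fin 13), CubLe j p q r →
    QuadLe j p q ∨ QuadLe j p r ∨ QuadLe j q r ∨
      (IsMixed p ∧ IsMixed q ∧ IsMixed r ∧ ∃ s, CubEq p q r j.castSucc s) ∨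
      (∃ s, QuadLe j r s ∧ ∃ t, QuadEq p q s t) ∨ (∃ s, QuadLe j q s ∧ ∃ t, QuadEq p r s t) ∨
      ∃ s, QuadLe j p s ∧ ∃ t, QuadEq q r s t := by
  decide +kernel

/-! ### Monomials in a commutative ring where the 35 binomials vanish -/

section Relations

variable {R : Type*} [CommRing R] {x : Fin 12 → R}

/-- The generators, followed by `1`. -/
def extend (x : Fin 12 → R) : Fin 13 → R :=
  ![x 0, x 1, x 2, x 3, x 4, x 5, x 6, x 7, x 8, x 9, x 10, x 11, 1]

theorem extend_castSucc (x : Fin 12 → R) (j : Fin 12) : extend x j.castSucc = x j := by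
  fin_cases j <;> rfl

theorem extend_last (x : Fin 12 → R) : extend x 12 = 1 := rfl

theorem quad_of_mem_table (h : relations x = 0) :
    ∀ t ∈ quadTable, extend x t.1 * extend x t.2.1 = extend x t.2.2.1 * extend x t.2.2.2 := by
  have r (i : Fin 35) : relations x i = 0 := congrFun h i
  simp only [quadTable, List.forall_mem_cons, List.not_mem_nil, false_imp_iff, implies_true,
    and_true, extend]
  refine ⟨?_, ?_, ?_, ?_, ?_, ?_, ?_, ?_, ?_, ?_, ?_, ?_, ?_, ?_, ?_, ?_, ?_, ?_, ?_⟩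
  · have e : x 6 * x 9 - x 7 * x 10 = 0 := r 0
    change x 6 * x 9 = x 7 * x 10
    linear_combination e
  · have e : x 5 * x 8 - x 7 * x 11 = 0 := r 1
    change x 5 * x 8 = x 7 * x 11
    linear_combination e
  · have e : x 4 * x 9 - x 5 * x 10 = 0 := r 2
    change x 4 * x 9 = x 5 * x 10
    linear_combination e
  · have e : x 4 * x 8 - x 6 * x 11 = 0 := r 3
    change x 4 * x 8 = x 6 * x 11
    linear_combination e
  · have e : x 4 * x 7 - x 5 * x 6 = 0 := r 4
    change x 4 * x 7 = x 5 * x 6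
    linear_combination e
  · have e : x 3 * x 10 - x 9 ^ 2 = 0 := r 10
    change x 3 * x 10 = x 9 * x 9
    linear_combination e
  · have e : x 3 * x 6 - x 7 * x 9 = 0 := r 12
    change x 3 * x 6 = x 7 * x 9
    linear_combination e
  · have e : x 3 * x 4 - x 5 * x 9 = 0 := r 13
    change x 3 * x 4 = x 5 * x 9
    linear_combination e
  · have e : x 2 * x 11 - x 8 ^ 2 = 0 := r 14
    change x 2 * x 11 = x 8 * x 8
    linear_combination e
  · have e : x 2 * x 5 - x 7 * x 8 = 0 := r 17
    change x 2 * x 5 = x 7 * x 8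
    linear_combination e
  · have e : x 2 * x 4 - x 6 * x 8 = 0 := r 18
    change x 2 * x 4 = x 6 * x 8
    linear_combination e
  · have e : x 1 * x 9 - x 10 ^ 2 = 0 := r 21
    change x 1 * x 9 = x 10 * x 10
    linear_combination e
  · have e : x 1 * x 7 - x 6 * x 10 = 0 := r 23
    change x 1 * x 7 = x 6 * x 10
    linear_combination e
  · have e : x 1 * x 5 - x 4 * x 10 = 0 := r 24
    change x 1 * x 5 = x 4 * x 10
    linear_combination e
  · have e : x 1 * x 3 - x 9 * x 10 = 0 := r 25
    change x 1 * x 3 = x 9 * x 10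
    linear_combination e
  · have e : x 0 * x 8 - x 11 ^ 2 = 0 := r 29
    change x 0 * x 8 = x 11 * x 11
    linear_combination e
  · have e : x 0 * x 7 - x 5 * x 11 = 0 := r 30
    change x 0 * x 7 = x 5 * x 11
    linear_combination e
  · have e : x 0 * x 6 - x 4 * x 11 = 0 := r 31
    change x 0 * x 6 = x 4 * x 11
    linear_combination e
  · have e : x 0 * x 2 - x 8 * x 11 = 0 := r 33
    change x 0 * x 2 = x 8 * x 11
    linear_combination e

theorem cub_of_mem_table (h : relations x = 0) :
    ∀ t ∈ cubTable, extend x t.1 * extend x t.2.1 * extend x t.2.2.1 =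
      extend x t.2.2.2.1 * extend x t.2.2.2.2 := by
  have r (i : Fin 35) : relations x i = 0 := congrFun h i
  simp only [cubTable, List.forall_mem_cons, List.not_mem_nil, false_imp_iff, implies_true,
    and_true, extend]
  refine ⟨?_, ?_, ?_, ?_, ?_, ?_, ?_, ?_, ?_, ?_, ?_, ?_, ?_, ?_, ?_, ?_, ?_, ?_, ?_, ?_⟩
  · have e : x 5 * x 6 * x 7 - x 8 * x 9 = 0 := r 5
    change x 5 * x 6 * x 7 = x 8 * x 9
    linear_combination e
  · have e : x 5 * x 6 ^ 2 - x 8 * x 10 = 0 := r 6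
    change x 5 * x 6 * x 6 = x 8 * x 10
    linear_combination e
  · have e : x 5 ^ 2 * x 6 - x 9 * x 11 = 0 := r 7
    change x 5 * x 5 * x 6 = x 9 * x 11
    linear_combination e
  · have e : x 4 * x 5 * x 6 - x 10 * x 11 = 0 := r 8
    change x 4 * x 5 * x 6 = x 10 * x 11
    linear_combination e
  · have e : x 3 * x 11 - x 5 ^ 2 * x 7 = 0 := r 9
    change x 5 * x 5 * x 7 = x 3 * x 11
    linear_combination -e
  · have e : x 3 * x 8 - x 5 * x 7 ^ 2 = 0 := r 11
    change x 5 * x 7 * x 7 = x 3 * x 8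
    linear_combination -e
  · have e : x 2 * x 10 - x 6 ^ 2 * x 7 = 0 := r 15
    change x 6 * x 6 * x 7 = x 2 * x 10
    linear_combination -e
  · have e : x 2 * x 9 - x 6 * x 7 ^ 2 = 0 := r 16
    change x 6 * x 7 * x 7 = x 2 * x 9
    linear_combination -e
  · have e : x 2 * x 3 - x 7 ^ 3 = 0 := r 19
    change x 7 * x 7 * x 7 = x 2 * x 3
    linear_combination -e
  · have e : x 1 * x 11 - x 4 ^ 2 * x 6 = 0 := r 20
    change x 4 * x 4 * x 6 = x 1 * x 11
    linear_combination -e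
  · have e : x 1 * x 8 - x 4 * x 6 ^ 2 = 0 := r 22
    change x 4 * x 6 * x 6 = x 1 * x 8
    linear_combination -e
  · have e : x 1 * x 2 - x 6 ^ 3 = 0 := r 26
    change x 6 * x 6 * x 6 = x 1 * x 2
    linear_combination -e
  · have e : x 0 * x 10 - x 4 ^ 2 * x 5 = 0 := r 27
    change x 4 * x 4 * x 5 = x 0 * x 10
    linear_combination -e
  · have e : x 0 * x 9 - x 4 * x 5 ^ 2 = 0 := r 28
    change x 4 * x 5 * x 5 = x 0 * x 9
    linear_combination -e
  · have e : x 0 * x 3 - x 5 ^ 3 = 0 := r 32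
    change x 5 * x 5 * x 5 = x 0 * x 3
    linear_combination -e
  · have e : x 0 * x 1 - x 4 ^ 3 = 0 := r 34
    change x 4 * x 4 * x 4 = x 0 * x 1
    linear_combination -e
  -- The last four entries are not among the 35 binomials. Each follows from one of them and a
  -- multiple of x₅x₈ = x₆x₇.
  · have e : x 4 * x 5 * x 6 - x 10 * x 11 = 0 := r 8
    have e' : x 4 * x 7 - x 5 * x 6 = 0 := r 4
    change x 4 * x 4 * x 7 = x 10 * x 11
    linear_combination e + x 4 * e'
  · have e : x 5 * x 6 * x 7 - x 8 * x 9 = 0 := r 5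
    have e' : x 4 * x 7 - x 5 * x 6 = 0 := r 4
    change x 4 * x 7 * x 7 = x 8 * x 9
    linear_combination e + x 7 * e'
  · have e : x 5 ^ 2 * x 6 - x 9 * x 11 = 0 := r 7
    have e' : x 4 * x 7 - x 5 * x 6 = 0 := r 4
    change x 4 * x 5 * x 7 = x 9 * x 11
    linear_combination e + x 5 * e'
  · have e : x 5 * x 6 ^ 2 - x 8 * x 10 = 0 := r 6
    have e' : x 4 * x 7 - x 5 * x 6 = 0 := r 4
    change x 4 * x 6 * x 7 = x 8 * x 10
    linear_combination e + x 6 * e'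

theorem extend_mul_eq (h : relations x = 0) {p q r s : Fin 13} (e : QuadEq p q r s) :
    extend x p * extend x q = extend x r * extend x s := by
  have key : ∀ p q r s : Fin 13, QuadEq p q r s → p ≤ q → r ≤ s →
      extend x p * extend x q = extend x r * extend x s := by
    intro p q r s e h1 h2
    rcases quadEq_mem_table p q r s e h1 h2 with ⟨rfl, rfl⟩ | ht | ht
    · rfl
    · exact quad_of_mem_table h _ ht
    · exact (quad_of_mem_table h _ ht).symm
  obtain ⟨e0, e1, e2, e3⟩ := e
  rcases le_total p q with h1 | h1 <;> rcases le_total r s with h2 | h2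
  · exact key p q r s ⟨e0, e1, e2, e3⟩ h1 h2
  · rw [mul_comm (extend x r)]
    exact key p q s r ⟨by omega, by omega, by omega, by omega⟩ h1 h2
  · rw [mul_comm (extend x p)]
    exact key q p r s ⟨by omega, by omega, by omega, by omega⟩ h1 h2
  · rw [mul_comm (extend x p), mul_comm (extend x r)]
    exact key q p s r ⟨by omega, by omega, by omega, by omega⟩ h1 h2

theorem extend_mul_mul_eq (h : relations x = 0) {p q r s t : Fin 13} (hp : IsMixed p)
    (hq : IsMixed q) (hr : IsMixed r) (e : CubEq p q r s t) :
    extend x p * extend x q * extend x r = extend x s * extend x t := by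
  have key : ∀ p q r s t : Fin 13, IsMixed p → IsMixed q → IsMixed r → p ≤ q → q ≤ r → s ≤ t →
      CubEq p q r s t → extend x p * extend x q * extend x r = extend x s * extend x t :=
    fun p q r s t hp hq hr h1 h2 h3 e =>
      cub_of_mem_table h _ (cubEq_mem_table p q r hp hq hr h1 h2 s t h3 e)
  have key' : ∀ p q r s t : Fin 13, IsMixed p → IsMixed q → IsMixed r → p ≤ q → q ≤ r →
      CubEq p q r s t → extend x p * extend x q * extend x r = extend x s * extend x t := by
    intro p q r s t hp hq hr h1 h2 e
    rcases le_total s t with h3 | h3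
    · exact key p q r s t hp hq hr h1 h2 h3 e
    · obtain ⟨e0, e1, e2, e3⟩ := e
      rw [mul_comm (extend x s)]
      exact key p q r t s hp hq hr h1 h2 h3 ⟨by omega, by omega, by omega, by omega⟩
  obtain ⟨e0, e1, e2, e3⟩ := e
  rcases le_total p q with h1 | h1 <;> rcases le_total q r with h2 | h2 <;>
    rcases le_total p r with h3 | h3
  · exact key' p q r s t hp hq hr h1 h2 ⟨e0, e1, e2, e3⟩
  · exact key' p q r s t hp hq hr h1 h2 ⟨e0, e1, e2, e3⟩
  · rw [mul_right_comm]
    exact key' p r q s t hp hr hq h3 h2 ⟨by omega, by omega, by omega, by omega⟩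
  · rw [mul_comm, ← mul_assoc]
    exact key' r p q s t hr hp hq h3 h1 ⟨by omega, by omega, by omega, by omega⟩
  · rw [mul_comm (extend x p)]
    exact key' q p r s t hq hp hr h1 h3 ⟨by omega, by omega, by omega, by omega⟩
  · rw [mul_assoc, mul_comm]
    exact key' q r p s t hq hr hp h2 h3 ⟨by omega, by omega, by omega, by omega⟩
  · rw [mul_comm, mul_comm (extend x p), ← mul_assoc]
    exact key' r q p s t hr hq hp h2 h1 ⟨by omega, by omega, by omega, by omega⟩
  · rw [mul_comm, mul_comm (extend x p), ← mul_assoc]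
    exact key' r q p s t hr hq hp h2 h1 ⟨by omega, by omega, by omega, by omega⟩

/-- The degree of a monomial, given by the multiset of its factors. -/
def multiDeg (l : Multiset (Fin 12)) : Fin 4 → ℕ := (l.map hilbW).sum

theorem multiDeg_add (l m : Multiset (Fin 12)) : multiDeg (l + m) = multiDeg l + multiDeg m := by
  simp [multiDeg]

theorem multiDeg_cons (j : Fin 12) (l : Multiset (Fin 12)) :
    multiDeg (j ::ₘ l) = hilbW j + multiDeg l := by
  simp [multiDeg]

theorem exists_multiset (x : Fin 12 → R) (s : Fin 13) : ∃ l : Multiset (Fin 12),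
    extend x s = (l.map x).prod ∧ genDeg s = multiDeg l := by
  induction s using Fin.lastCases with
  | last => exact ⟨0, by simp [extend_last], by simp [genDeg_last, multiDeg]⟩
  | cast j => exact ⟨{j}, by simp [extend_castSucc], by simp [genDeg_castSucc, multiDeg]⟩

theorem QuadEq.add_eq {p q r s : Fin 13} (e : QuadEq p q r s) :
    genDeg p + genDeg q = genDeg r + genDeg s := by
  obtain ⟨e0, e1, e2, e3⟩ := e
  ext i; fin_cases i <;> assumption

theorem CubEq.add_eq {p q r s t : Fin 13} (e : CubEq p q r s t) :
    genDeg p + genDeg q + genDeg r = genDeg s + genDeg t := by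
  obtain ⟨e0, e1, e2, e3⟩ := e
  ext i; fin_cases i <;> assumption

theorem quad_dvd (h : relations x = 0) {j : Fin 12} {p q : Fin 13} (hj : QuadLe j p q) :
    ∃ l : Multiset (Fin 12), extend x p * extend x q = x j * (l.map x).prod ∧
      genDeg p + genDeg q = hilbW j + multiDeg l := by
  rcases quad_exists j p q hj with ⟨s, e⟩ | ⟨s, t, h1, h2, h3, e⟩
  · obtain ⟨l, hl, hl'⟩ := exists_multiset x s
    refine ⟨l, ?_, ?_⟩
    · rw [extend_mul_eq h e, extend_castSucc, hl]
    · rw [← genDeg_castSucc, ← hl', e.add_eq]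
  · obtain ⟨l, hl, hl'⟩ := exists_multiset x s
    obtain ⟨m, hm, hm'⟩ := exists_multiset x t
    refine ⟨l + m, ?_, ?_⟩
    · rw [← extend_mul_mul_eq h h1 h2 h3 e, extend_castSucc, hl, hm, Multiset.map_add,
        Multiset.prod_add, mul_assoc]
    · rw [multiDeg_add, ← genDeg_castSucc, ← add_assoc, ← hl', ← hm', e.add_eq]

theorem quad_dvd_mul (h : relations x = 0) {j : Fin 12} {p q : Fin 13} (r : Fin 13)
    (hj : QuadLe j p q) :
    ∃ l : Multiset (Fin 12), extend x p * extend x q * extend x r = x j * (l.map x).prod ∧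
      genDeg p + genDeg q + genDeg r = hilbW j + multiDeg l := by
  obtain ⟨l, hl, hl'⟩ := quad_dvd h hj
  obtain ⟨m, hm, hm'⟩ := exists_multiset x r
  refine ⟨l + m, ?_, ?_⟩
  · rw [hl, hm, Multiset.map_add, Multiset.prod_add, mul_assoc]
  · rw [hl', hm', add_assoc, multiDeg_add]

theorem cub_dvd (h : relations x = 0) {j : Fin 12} {p q r : Fin 13} (hj : CubLe j p q r) :
    ∃ l : Multiset (Fin 12), extend x p * extend x q * extend x r = x j * (l.map x).prod ∧
      genDeg p + genDeg q + genDeg r = hilbW j + multiDeg l := by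
  rcases cub_exists j p q r hj with h1 | h1 | h1 | ⟨h1, h2, h3, s, e⟩ | ⟨s, h1, t, e⟩ |
      ⟨s, h1, t, e⟩ | ⟨s, h1, t, e⟩
  · exact quad_dvd_mul h r h1
  · rw [mul_right_comm, add_right_comm]
    exact quad_dvd_mul h q h1
  · rw [mul_assoc, mul_comm, add_assoc, add_comm]
    exact quad_dvd_mul h p h1
  · obtain ⟨l, hl, hl'⟩ := exists_multiset x s
    refine ⟨l, ?_, ?_⟩
    · rw [extend_mul_mul_eq h h1 h2 h3 e, extend_castSucc, hl]
    · rw [← genDeg_castSucc, ← hl', e.add_eq]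
  · rw [extend_mul_eq h e, e.add_eq, mul_right_comm, mul_comm (extend x s), add_right_comm,
      add_comm (genDeg s)]
    exact quad_dvd_mul h t h1
  · rw [mul_right_comm, extend_mul_eq h e, mul_right_comm, mul_comm (extend x s), add_right_comm,
      e.add_eq, add_right_comm, add_comm (genDeg s)]
    exact quad_dvd_mul h t h1
  · rw [mul_assoc, extend_mul_eq h e, ← mul_assoc, add_assoc, e.add_eq, ← add_assoc]
    exact quad_dvd_mul h t h1

/-- Greedy choice: a factor that is positive in a coordinate still uncovered lowers the uncovered
total by at least one, so n factors suffice. -/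
theorem exists_sub_of_le_multiDeg (n : ℕ) (d : Fin 4 → ℕ) (hd : ∑ i, d i ≤ n)
    (l : Multiset (Fin 12)) (hl : d ≤ multiDeg l) :
    ∃ s ≤ l, Multiset.card s ≤ n ∧ d ≤ multiDeg s := by
  induction n generalizing d l with
  | zero =>
    refine ⟨0, Multiset.zero_le _, by simp, fun i => ?_⟩
    have := Finset.single_le_sum (f := d) (fun _ _ => Nat.zero_le _) (Finset.mem_univ i)
    exact (this.trans hd).trans (Nat.zero_le _)
  | succ n ih =>
    by_cases h0 : d = 0
    · exact ⟨0, Multiset.zero_le _, by simp, by simp [h0, multiDeg]⟩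
    · obtain ⟨i, hi⟩ := Function.ne_iff.1 h0
      have hi' : 0 < d i := Nat.pos_of_ne_zero hi
      obtain ⟨p, hp, hpi⟩ : ∃ p ∈ l, 0 < hilbW p i := by
        by_contra! hcon
        have : multiDeg l i = 0 := by
          have e : multiDeg l i = (l.map fun p => hilbW p i).sum := by
            have e := map_multiset_sum (Pi.evalAddMonoidHom (fun _ : Fin 4 => ℕ) i) (l.map hilbW)
            rwa [Multiset.map_map] at e
          rw [e, Multiset.sum_eq_zero]
          intro y hy
          obtain ⟨p, hp, rfl⟩ := Multiset.mem_map.1 hy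
          have := hcon p hp
          omega
        exact hi (Nat.le_zero.1 (this ▸ hl i))
      obtain ⟨m, rfl⟩ := Multiset.exists_cons_of_mem hp
      rw [multiDeg_cons] at hl
      -- The subtraction is truncated; it is strict in coordinate `i`, where both terms are
      -- positive.
      have hlt : ∑ k, (d - hilbW p) k < ∑ k, d k :=
        Finset.sum_lt_sum (fun k _ => Nat.sub_le _ _)
          ⟨i, Finset.mem_univ _, Nat.sub_lt hi' hpi⟩
      obtain ⟨s, hs, hc, hds⟩ := ih (d - hilbW p) (by omega) m (fun k => by
        have := hl k
        simp only [Pi.add_apply, Pi.sub_apply] at this ⊢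
        omega)
      refine ⟨p ::ₘ s, Multiset.cons_le_cons _ hs, by simpa using hc, fun k => ?_⟩
      have := hds k
      simp only [multiDeg_cons, Pi.add_apply, Pi.sub_apply] at this ⊢
      omega

theorem exists_extend_eq (x : Fin 12 → R) (s : Multiset (Fin 12)) (hs : Multiset.card s ≤ 3) :
    ∃ p q r : Fin 13, (s.map x).prod = extend x p * extend x q * extend x r ∧
      multiDeg s = genDeg p + genDeg q + genDeg r := by
  have hc : Multiset.card s = 0 ∨ Multiset.card s = 1 ∨ Multiset.card s = 2 ∨
    Multiset.card s = 3 := by omega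
  rcases hc with h | h | h | h
  · rw [Multiset.card_eq_zero] at h
    exact ⟨12, 12, 12, by simp [h, extend_last],
      by simp [h, genDeg_last, multiDeg]⟩
  · obtain ⟨a, rfl⟩ := Multiset.card_eq_one.1 h
    exact ⟨a.castSucc, 12, 12, by simp [extend_last, extend_castSucc],
      by simp [genDeg_last, multiDeg, genDeg_castSucc]⟩
  · obtain ⟨a, b, rfl⟩ := Multiset.card_eq_two.1 h
    exact ⟨a.castSucc, b.castSucc, 12, by simp [extend_last, extend_castSucc],
      by simp [genDeg_last, multiDeg, genDeg_castSucc]⟩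
  · obtain ⟨a, b, c, rfl⟩ := Multiset.card_eq_three.1 h
    exact ⟨a.castSucc, b.castSucc, c.castSucc, by simp [extend_castSucc, mul_assoc],
      by simp [multiDeg, genDeg_castSucc, add_assoc]⟩

/-- Every generator has total degree at most 3, so at most three factors of `l` cover the degree of
x_j. The relations extract x_j from these, and the remaining factors are carried along. -/
theorem exists_cons_of_le (h : relations x = 0) (j : Fin 12) (l : Multiset (Fin 12))
    (hj : hilbW j ≤ multiDeg l) :
    ∃ m : Multiset (Fin 12), (l.map x).prod = x j * (m.map x).prod ∧
      multiDeg l = hilbW j + multiDeg m := by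
  have h3 : ∀ j : Fin 12, ∑ i, hilbW j i ≤ 3 := by decide
  obtain ⟨s, hs, hc, hds⟩ := exists_sub_of_le_multiDeg 3 _ (h3 j) l hj
  obtain ⟨t, rfl⟩ := Multiset.le_iff_exists_add.1 hs
  obtain ⟨p, q, r, he, hd⟩ := exists_extend_eq x s hc
  rw [hd] at hds
  obtain ⟨m, hm, hm'⟩ := cub_dvd h (j := j) (p := p) (q := q) (r := r)
    ⟨hds 0, hds 1, hds 2, hds 3⟩
  refine ⟨m + t, ?_, ?_⟩
  · rw [Multiset.map_add, Multiset.prod_add, he, hm, Multiset.map_add, Multiset.prod_add,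
      mul_assoc]
  · rw [multiDeg_add, hd, hm', multiDeg_add, add_assoc]

/-- If `x₁, …, x₁₂` satisfy the relations, then the value of a monomial in them depends on its
degree only. -/
theorem prod_eq_of_multiDeg_eq (h : relations x = 0) (l m : Multiset (Fin 12))
    (hlm : multiDeg l = multiDeg m) : (l.map x).prod = (m.map x).prod := by
  induction m using Multiset.induction generalizing l with
  | empty =>
    suffices l = 0 by rw [this]
    refine Multiset.eq_zero_of_forall_notMem fun p hp => ?_
    obtain ⟨m, rfl⟩ := Multiset.exists_cons_of_mem hp
    have hpos : ∀ p : Fin 12, hilbW p ≠ 0 := by decide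
    refine hpos p (funext fun i => ?_)
    have := congrFun hlm i
    rw [multiDeg_cons] at this
    simp only [multiDeg, Multiset.map_zero, Multiset.sum_zero, Pi.add_apply, Pi.zero_apply] at this
    simp only [Pi.zero_apply]
    omega
  | cons j m ih =>
    obtain ⟨l', hl, hl'⟩ := exists_cons_of_le h j l (by
      rw [hlm, multiDeg_cons]
      exact le_self_add)
    rw [hl, Multiset.map_cons, Multiset.prod_cons, ih l']
    rw [multiDeg_cons, hl'] at hlm
    exact add_left_cancel hlm

end Relations

/-! ### Hilbert bases -/

/-- Since `N` is closed under differences, any `H j` below an element of `N` splits off inside `N`.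
Generation follows by induction on the coordinate sum, and since `H` is an antichain its members are
exactly the indecomposables. -/
theorem isHilbertBasis_of_exists_le {n : ℕ} {N : AddSubmonoid (Fin n → ℕ)} {ι : Type*} [Finite ι]
    {H : ι → Fin n → ℕ} (hN : ∀ a ∈ N, ∀ b ∈ N, ∀ c, a = b + c → c ∈ N)
    (hH : ∀ j, H j ∈ N) (h0 : ∀ j, H j ≠ 0) (hmin : ∀ i j, H i ≤ H j → i = j)
    (hex : ∀ k ∈ N, k ≠ 0 → ∃ j, H j ≤ k) : IsHilbertBasis N (Set.range H) where
  positive a _ b _ h := by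
    ext i
    have := congrFun h i
    simp only [Pi.add_apply, Pi.zero_apply] at this ⊢
    omega
  finite := Set.finite_range H
  closure_eq := by
    refine le_antisymm (AddSubmonoid.closure_le.2 ?_) fun k hk => ?_
    · rintro _ ⟨j, rfl⟩
      exact hH j
    · induction hn : ∑ i, k i using Nat.strong_induction_on generalizing k with
      | _ m ih =>
        by_cases hk0 : k = 0
        · rw [hk0]; exact zero_mem _
        · obtain ⟨j, hj⟩ := hex k hk hk0
          obtain ⟨c, hc⟩ := le_iff_exists_add.1 hj
          have hcN := hN k hk (H j) (hH j) c hc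
          rw [hc]
          refine add_mem (AddSubmonoid.subset_closure ⟨j, rfl⟩) (ih _ ?_ c hcN rfl)
          obtain ⟨i, hi⟩ := Function.ne_iff.1 (h0 j)
          have hpos : 0 < ∑ i, H j i :=
            Finset.sum_pos' (fun _ _ => Nat.zero_le _) ⟨i, Finset.mem_univ _, Nat.pos_of_ne_zero hi⟩
          have : ∑ i, k i = ∑ i, H j i + ∑ i, c i := by
            rw [hc, ← Finset.sum_add_distrib]; rfl
          omega
  eq_indecomposables := by
    ext k
    constructor
    · rintro ⟨j, rfl⟩
      refine ⟨hH j, h0 j, fun a ha b hb hab => ?_⟩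
      by_contra! hcon
      -- Some `H i` lies below `a`, hence below `H j = a + b`. The antichain condition gives `i =
      -- j`, so `a` is all of `H j` and `b = 0`.
      obtain ⟨i, hi⟩ := hex a ha hcon.1
      have hij : i = j := hmin i j (hi.trans (hab ▸ le_self_add))
      subst hij
      apply hcon.2
      ext t
      have h1 : H i t ≤ a t := hi t
      have h2 := congrFun hab t
      simp only [Pi.add_apply, Pi.zero_apply] at h2 ⊢
      omega
    · rintro ⟨hk, hk0, hind⟩
      obtain ⟨j, hj⟩ := hex k hk hk0
      obtain ⟨c, hc⟩ := le_iff_exists_add.1 hj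
      rcases hind _ (hH j) c (hN k hk (H j) (hH j) c hc) hc with h | h
      · exact absurd h (h0 j)
      · exact ⟨j, by rw [hc, h, add_zero]⟩

theorem IsHilbertBasis.map {A B : Type*} [AddCommMonoid A] [AddCommMonoid B] {N : AddSubmonoid A}
    {H : Set A} (h : IsHilbertBasis N H) (f : A →+ B) (hf : Function.Injective f) :
    IsHilbertBasis (N.map f) (f '' H) where
  positive := by
    rintro _ ⟨a, ha, rfl⟩ _ ⟨b, hb, rfl⟩ hab
    rw [← map_add, map_eq_zero_iff f hf] at hab
    rw [h.positive a ha b hb hab, map_zero]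
  finite := h.finite.image f
  closure_eq := by rw [← AddMonoidHom.map_mclosure, h.closure_eq]
  eq_indecomposables := by
    conv_lhs => rw [h.eq_indecomposables]
    ext m
    constructor
    · rintro ⟨m, ⟨hm, hm0, hind⟩, rfl⟩
      refine ⟨⟨m, hm, rfl⟩, (map_ne_zero_iff f hf).2 hm0, ?_⟩
      rintro _ ⟨a, ha, rfl⟩ _ ⟨b, hb, rfl⟩ hab
      rw [← map_add] at hab
      exact (hind a ha b hb (hf hab)).imp (fun e => by rw [e, map_zero])
        (fun e => by rw [e, map_zero])
    · rintro ⟨⟨m, hm, rfl⟩, hm0, hind⟩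
      refine ⟨m, ⟨hm, (map_ne_zero_iff f hf).1 hm0, fun a ha b hb hab => ?_⟩, rfl⟩
      exact (hind _ ⟨a, ha, rfl⟩ _ ⟨b, hb, rfl⟩ (by rw [hab, map_add])).imp
        (map_eq_zero_iff f hf).1 (map_eq_zero_iff f hf).1

theorem mem_W {k : Fin 4 → ℕ} : k ∈ W ↔ 3 ∣ k 0 + 2 * k 1 + k 2 + 2 * k 3 := Iff.rfl

theorem mem_coordMonoid {l : Fin 6 → ℕ} :
    l ∈ coordMonoid ↔ 3 ∣ l 0 + 2 * l 2 + l 4 + 2 * l 5 := Iff.rfl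

theorem hilbW_mem (j : Fin 12) : hilbW j ∈ W := by
  rw [mem_W]
  revert j
  decide

theorem hilbW_injective : Function.Injective hilbW := by decide

/-- A coordinate that is at least 3 dominates one of m₁, …, m₄; otherwise only the box {0, 1, 2}⁴
remains. -/
theorem exists_hilbW_le (k : Fin 4 → ℕ) (hk : k ∈ W) (h0 : k ≠ 0) : ∃ j, hilbW j ≤ k := by
  have hle : ∀ j, hilbW j 0 ≤ k 0 → hilbW j 1 ≤ k 1 → hilbW j 2 ≤ k 2 → hilbW j 3 ≤ k 3 →
      hilbW j ≤ k := by
    intro j h0 h1 h2 h3 i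
    fin_cases i <;> assumption
  by_cases h : k 0 < 3 ∧ k 1 < 3 ∧ k 2 < 3 ∧ k 3 < 3
  · have key : ∀ a b c d : Fin 3, 3 ∣ (a : ℕ) + 2 * b + c + 2 * d →
        ¬ ((a : ℕ) = 0 ∧ (b : ℕ) = 0 ∧ (c : ℕ) = 0 ∧ (d : ℕ) = 0) → ∃ j : Fin 12,
        hilbW j 0 ≤ a ∧ hilbW j 1 ≤ b ∧ hilbW j 2 ≤ c ∧ hilbW j 3 ≤ d := by decide +kernel
    obtain ⟨h1, h2, h3, h4⟩ := h
    obtain ⟨j, h5, h6, h7, h8⟩ := key ⟨k 0, h1⟩ ⟨k 1, h2⟩ ⟨k 2, h3⟩ ⟨k 3, h4⟩ hk (by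
      rintro ⟨e0, e1, e2, e3⟩
      apply h0
      ext i
      fin_cases i <;> assumption)
    exact ⟨j, hle j h5 h6 h7 h8⟩
  · have : 3 ≤ k 0 ∨ 3 ≤ k 1 ∨ 3 ≤ k 2 ∨ 3 ≤ k 3 := by omega
    rcases this with h | h | h | h
    · exact ⟨0, hle 0 h (Nat.zero_le _) (Nat.zero_le _) (Nat.zero_le _)⟩
    · exact ⟨1, hle 1 (Nat.zero_le _) h (Nat.zero_le _) (Nat.zero_le _)⟩
    · exact ⟨2, hle 2 (Nat.zero_le _) (Nat.zero_le _) h (Nat.zero_le _)⟩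
    · exact ⟨3, hle 3 (Nat.zero_le _) (Nat.zero_le _) (Nat.zero_le _) h⟩

theorem isHilbertBasis_W : IsHilbertBasis W (Set.range hilbW) := by
  refine isHilbertBasis_of_exists_le ?_ hilbW_mem (by decide) ?_ exists_hilbW_le
  · rintro a ha b hb c rfl
    simp only [mem_W, Pi.add_apply] at *
    omega
  · simp only [Pi.le_def]
    decide +kernel

/-- The fourteen elements of the Hilbert basis in coordinates. -/
def hilbCoord : Fin 2 ⊕ Fin 12 → Fin 6 → ℕ :=
  Sum.elim ![Pi.single 1 1, Pi.single 3 1] fun j => insertCoords 0 0 (hilbW j)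

theorem hilbCoord_injective : Function.Injective hilbCoord := by
  have : ∀ i j, hilbCoord i = hilbCoord j → i = j := by decide +kernel
  exact this

theorem single_le {n : ℕ} (k : Fin n → ℕ) {i : Fin n} (h : k i ≠ 0) : Pi.single i 1 ≤ k := by
  intro t
  by_cases ht : t = i
  · subst ht
    rw [Pi.single_eq_same]
    exact Nat.one_le_iff_ne_zero.2 h
  · rw [Pi.single_eq_of_ne ht]
    exact Nat.zero_le _

/-- The congruence ignores coordinates 1 and 3, so a nonzero one splits off a unit vector. If both
vanish, the question is the one for `W`. -/
theorem isHilbertBasis_coordMonoid : IsHilbertBasis coordMonoid (Set.range hilbCoord) := by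
  refine isHilbertBasis_of_exists_le ?_ ?_ (by decide +kernel) ?_ ?_
  · rintro a ha b hb c rfl
    simp only [mem_coordMonoid, Pi.add_apply] at *
    omega
  · simp only [mem_coordMonoid]
    decide +kernel
  · simp only [Pi.le_def]
    decide +kernel
  · intro k hk h0
    by_cases h1 : k 1 = 0
    · by_cases h3 : k 3 = 0
      · obtain ⟨j, hj⟩ := exists_hilbW_le ![k 0, k 2, k 4, k 5] hk (by
          intro e
          apply h0
          have e0 := congrFun e 0
          have e1 := congrFun e 1
          have e2 := congrFun e 2
          have e3 := congrFun e 3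
          ext i
          fin_cases i <;> assumption)
        refine ⟨Sum.inr j, fun i => ?_⟩
        have e0 := hj 0
        have e1 := hj 1
        have e2 := hj 2
        have e3 := hj 3
        fin_cases i
        · exact e0
        · exact Nat.zero_le _
        · exact e1
        · exact Nat.zero_le _
        · exact e2
        · exact e3
      · refine ⟨Sum.inl 1, ?_⟩
        exact single_le k h3
    · refine ⟨Sum.inl 0, ?_⟩
      exact single_le k h1

/-! ### Explicit coordinates for the simple roots and fundamental weights -/

theorem mem_E {v : V} : v ∈ E ↔ v 5 = v 6 ∧ v 6 = -v 7 := by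
  have : E = (Submodule.span ℝ {e 5 - e 6})ᗮ ⊓ (Submodule.span ℝ {e 6 + e 7})ᗮ := by
    rw [E, Submodule.span_insert, Submodule.inf_orthogonal]
  rw [this, Submodule.mem_inf, Submodule.mem_orthogonal_singleton_iff_inner_left,
    Submodule.mem_orthogonal_singleton_iff_inner_left]
  simp [e, inner_add_right, inner_sub_right, EuclideanSpace.inner_single_right, sub_eq_zero,
    add_eq_zero_iff_eq_neg]

theorem inner_simpleRoot (v : V) :
    inner ℝ v (simpleRoot 0) = (v 0 + v 7 - (v 1 + v 2 + v 3 + v 4 + v 5 + v 6)) / 2 ∧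
    inner ℝ v (simpleRoot 1) = v 0 + v 1 ∧ inner ℝ v (simpleRoot 2) = v 1 - v 0 ∧
    inner ℝ v (simpleRoot 3) = v 2 - v 1 ∧ inner ℝ v (simpleRoot 4) = v 3 - v 2 ∧
    inner ℝ v (simpleRoot 5) = v 4 - v 3 := by
  simp [simpleRoot, e, inner_add_right, inner_sub_right, inner_smul_right,
    EuclideanSpace.inner_single_right]
  ring

theorem inner_weight (v : V) :
    inner ℝ v (weight 0) = 2 / 3 * (v 7 - v 6 - v 5) ∧
    inner ℝ v (weight 1) = (v 0 + v 1 + v 2 + v 3 + v 4 - v 5 - v 6 + v 7) / 2 ∧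
    inner ℝ v (weight 2) = 5 / 6 * (v 7 - v 6 - v 5) + (-v 0 + v 1 + v 2 + v 3 + v 4) / 2 ∧
    inner ℝ v (weight 3) = v 2 + v 3 + v 4 - v 5 - v 6 + v 7 ∧
    inner ℝ v (weight 4) = 2 / 3 * (v 7 - v 6 - v 5) + v 3 + v 4 ∧
    inner ℝ v (weight 5) = 1 / 3 * (v 7 - v 6 - v 5) + v 4 := by
  simp [weight, e, inner_add_right, inner_sub_right, inner_smul_right, inner_neg_right,
    EuclideanSpace.inner_single_right]
  constructor <;> ring

theorem weight_mem_E (i : Fin 6) : weight i ∈ E := by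
  rw [mem_E]
  fin_cases i <;> simp [weight, e]

theorem inner_weight_simpleRoot (i j : Fin 6) :
    inner ℝ (weight i) (simpleRoot j) = if i = j then (1 : ℝ) else 0 := by
  obtain ⟨h0, h1, h2, h3, h4, h5⟩ := inner_simpleRoot (weight i)
  fin_cases j
  · refine h0.trans ?_
    fin_cases i <;> simp [weight, e] <;> norm_num
  · refine h1.trans ?_
    fin_cases i <;> (simp [weight, e]; try norm_num)
  · refine h2.trans ?_
    fin_cases i <;> (simp [weight, e]; try norm_num)
  · refine h3.trans ?_
    fin_cases i <;> simp [weight, e]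
  · refine h4.trans ?_
    fin_cases i <;> simp [weight, e]
  · refine h5.trans ?_
    fin_cases i <;> simp [weight, e]

theorem inner_simpleRoot_self (i : Fin 6) : inner ℝ (simpleRoot i) (simpleRoot i) = (2 : ℝ) := by
  obtain ⟨h0, h1, h2, h3, h4, h5⟩ := inner_simpleRoot (simpleRoot i)
  fin_cases i
  · refine h0.trans ?_
    simp [simpleRoot, e]; norm_num
  · refine h1.trans ?_
    simp [simpleRoot, e]; norm_num
  · refine h2.trans ?_
    simp [simpleRoot, e]; norm_num
  · refine h3.trans ?_
    simp [simpleRoot, e]; norm_num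
  · refine h4.trans ?_
    simp [simpleRoot, e]; norm_num
  · refine h5.trans ?_
    simp [simpleRoot, e]; norm_num

theorem bracket_weight_simpleRoot (i j : Fin 6) :
    bracket (weight i) (simpleRoot j) = if i = j then 1 else 0 := by
  rw [bracket, inner_weight_simpleRoot, inner_simpleRoot_self]
  split_ifs <;> norm_num

theorem eq_sum_weight {v : V} (hv : v ∈ E) :
    v = ∑ j, inner ℝ v (simpleRoot j) • weight j := by
  obtain ⟨h0, h1, h2, h3, h4, h5⟩ := inner_simpleRoot v
  obtain ⟨e1, e2⟩ := mem_E.1 hv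
  rw [Fin.sum_univ_six, h0, h1, h2, h3, h4, h5]
  ext i
  fin_cases i <;> simp [weight, e] <;> linarith

theorem eq_sum_simpleRoot {v : V} (hv : v ∈ E) :
    v = ∑ j, inner ℝ v (weight j) • simpleRoot j := by
  obtain ⟨h0, h1, h2, h3, h4, h5⟩ := inner_weight v
  obtain ⟨e1, e2⟩ := mem_E.1 hv
  rw [Fin.sum_univ_six, h0, h1, h2, h3, h4, h5]
  ext i
  fin_cases i <;> simp [simpleRoot, e] <;> linarith

/-! ### The lattices and the Weyl group -/

/-- `v` lies in `E` and its coordinates with respect to the fundamental weights are the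
integers `n`. -/
def HasLabels (v : V) (n : Fin 6 → ℤ) : Prop :=
  v ∈ E ∧ ∀ j, inner ℝ v (simpleRoot j) = (n j : ℝ)

theorem HasLabels.eq_sum {v : V} {n : Fin 6 → ℤ} (h : HasLabels v n) :
    v = ∑ j, (n j : ℝ) • weight j := by
  conv_lhs => rw [eq_sum_weight h.1]
  simp only [h.2]

theorem hasLabels_sum (n : Fin 6 → ℤ) : HasLabels (∑ j, (n j : ℝ) • weight j) n := by
  refine ⟨sum_mem fun j _ => Submodule.smul_mem _ _ (weight_mem_E j), fun j => ?_⟩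
  simp [sum_inner, inner_smul_left, inner_weight_simpleRoot]

theorem hasLabels_zero : HasLabels 0 0 := ⟨zero_mem _, fun j => by simp⟩

theorem HasLabels.add {v w : V} {n m : Fin 6 → ℤ} (hv : HasLabels v n) (hw : HasLabels w m) :
    HasLabels (v + w) (n + m) :=
  ⟨add_mem hv.1 hw.1, fun j => by simp [inner_add_left, hv.2, hw.2]⟩

theorem HasLabels.neg {v : V} {n : Fin 6 → ℤ} (hv : HasLabels v n) : HasLabels (-v) (-n) :=
  ⟨neg_mem hv.1, fun j => by simp [hv.2]⟩

theorem hasLabels_weight (i : Fin 6) : HasLabels (weight i) (Pi.single i 1) :=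
  ⟨weight_mem_E i, fun j => by
    rw [inner_weight_simpleRoot, Pi.single_apply]
    simp [eq_comm]⟩

theorem HasLabels.unique {v : V} {n m : Fin 6 → ℤ} (hv : HasLabels v n) (hw : HasLabels v m) :
    n = m := by
  ext j
  exact_mod_cast (hv.2 j).symm.trans (hw.2 j)

/-- The class of a weight modulo the root lattice. -/
def labelClass (n : Fin 6 → ℤ) : ℤ := n 0 + 2 * n 2 + n 4 + 2 * n 5

theorem labelClass_add (n m : Fin 6 → ℤ) : labelClass (n + m) = labelClass n + labelClass m := by
  simp only [labelClass, Pi.add_apply]; ring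

theorem labelClass_neg (n : Fin 6 → ℤ) : labelClass (-n) = -labelClass n := by
  simp only [labelClass, Pi.neg_apply]; ring

/-- Both kinds of roots have half-integral coordinates of this shape, with `d = 0` or `d = ±1`. The
parity condition makes the labels at α₂, …, α₆ integral; the condition mod 4 does so for α₁. -/
theorem exists_hasLabels_of_half {v : V} (c : Fin 5 → ℤ) (d : ℤ)
    (h0 : v 0 = c 0 / 2) (h1 : v 1 = c 1 / 2) (h2 : v 2 = c 2 / 2) (h3 : v 3 = c 3 / 2)
    (h4 : v 4 = c 4 / 2) (h5 : v 5 = -d / 2) (h6 : v 6 = -d / 2) (h7 : v 7 = d / 2)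
    (hpar : ∀ k, 2 ∣ c k - d) (hsum : 4 ∣ c 0 + 3 * d - c 1 - c 2 - c 3 - c 4) :
    ∃ n, HasLabels v n ∧ 3 ∣ labelClass n := by
  obtain ⟨m, hm⟩ := hsum
  obtain ⟨a0, g0⟩ := hpar 0
  obtain ⟨a1, g1⟩ := hpar 1
  obtain ⟨a2, g2⟩ := hpar 2
  obtain ⟨a3, g3⟩ := hpar 3
  obtain ⟨a4, g4⟩ := hpar 4
  obtain ⟨l0, l1, l2, l3, l4, l5⟩ := inner_simpleRoot v
  refine ⟨![m, a0 + a1 + d, a1 - a0, a2 - a1, a3 - a2, a4 - a3],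
    ⟨mem_E.2 ⟨by rw [h5, h6], by rw [h6, h7]; ring⟩, fun j => ?_⟩, ?_⟩
  · have hm' : (c 0 + 3 * d - c 1 - c 2 - c 3 - c 4 : ℝ) = 4 * m := by exact_mod_cast hm
    have g0' : (c 0 - d : ℝ) = 2 * a0 := by exact_mod_cast g0
    have g1' : (c 1 - d : ℝ) = 2 * a1 := by exact_mod_cast g1
    have g2' : (c 2 - d : ℝ) = 2 * a2 := by exact_mod_cast g2
    have g3' : (c 3 - d : ℝ) = 2 * a3 := by exact_mod_cast g3
    have g4' : (c 4 - d : ℝ) = 2 * a4 := by exact_mod_cast g4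
    fin_cases j
    · refine l0.trans ?_
      rw [h0, h1, h2, h3, h4, h5, h6, h7]
      simp
      linarith
    · refine l1.trans ?_
      rw [h0, h1]
      simp
      linarith
    · refine l2.trans ?_
      rw [h0, h1]
      simp
      linarith
    · refine l3.trans ?_
      rw [h1, h2]
      simp
      linarith
    · refine l4.trans ?_
      rw [h2, h3]
      simp
      linarith
    · refine l5.trans ?_
      rw [h3, h4]
      simp
      linarith
  · change 3 ∣ m + 2 * (a1 - a0) + (a3 - a2) + 2 * (a4 - a3)
    omega

theorem exists_hasLabels_of_mem_rootsD {v : V} (hv : v ∈ rootsD) :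
    ∃ n, HasLabels v n ∧ 3 ∣ labelClass n := by
  obtain ⟨i, j, -, s, t, hs, ht, rfl⟩ := hv
  obtain ⟨s', rfl, hs'⟩ : ∃ s' : ℤ, s = s' ∧ (s' = 1 ∨ s' = -1) := by
    rcases hs with rfl | rfl
    · exact ⟨1, by simp, by simp⟩
    · exact ⟨-1, by simp, by simp⟩
  obtain ⟨t', rfl, ht'⟩ : ∃ t' : ℤ, t = t' ∧ (t' = 1 ∨ t' = -1) := by
    rcases ht with rfl | rfl
    · exact ⟨1, by simp, by simp⟩
    · exact ⟨-1, by simp, by simp⟩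
  have hc : ∀ k : Fin 5, ((s' : ℝ) • e (i.castLE (by norm_num)) +
      (t' : ℝ) • e (j.castLE (by norm_num)) : V) (k.castLE (by norm_num)) =
      ((2 * (s' * (if k = i then 1 else 0) + t' * (if k = j then 1 else 0)) : ℤ) : ℝ) / 2 := by
    intro k
    simp [e]
  refine exists_hasLabels_of_half
    (fun k => 2 * (s' * (if k = i then 1 else 0) + t' * (if k = j then 1 else 0))) 0
    (hc 0) (hc 1) (hc 2) (hc 3) (hc 4) ?_ ?_ ?_ (fun k => by simp) ?_
  · have : ∀ i : Fin 5, (5 : Fin 8) ≠ i.castLE (by norm_num) := by decide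
    simp [e, this]
  · have : ∀ i : Fin 5, (6 : Fin 8) ≠ i.castLE (by norm_num) := by decide
    simp [e, this]
  · have : ∀ i : Fin 5, (7 : Fin 8) ≠ i.castLE (by norm_num) := by decide
    simp [e, this]
  -- The form c₀ - c₁ - c₂ - c₃ - c₄ is odd on each unit vector, so a signed sum of two such values
  -- is even, and the factor 2 in `c` makes it divisible by 4.
  · have key : ∀ i : Fin 5, ∃ m : ℤ, (if (0 : Fin 5) = i then (1 : ℤ) else 0) -
        (if 1 = i then 1 else 0) - (if 2 = i then 1 else 0) - (if 3 = i then 1 else 0) -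
        (if 4 = i then 1 else 0) = 2 * m + 1 := by
      intro i
      fin_cases i
      · exact ⟨0, rfl⟩
      all_goals exact ⟨-1, rfl⟩
    obtain ⟨m, hm⟩ := key i
    obtain ⟨m', hm'⟩ := key j
    rcases hs' with rfl | rfl <;> rcases ht' with rfl | rfl <;> omega

theorem rootsSpin_coord (ν : Fin 5 → Fin 2) (s : ℝ) :
    (∀ k : Fin 5, (s • ((1 / 2 : ℝ) • (e 7 - e 6 - e 5 +
      ∑ i : Fin 5, ((-1 : ℝ) ^ (ν i : ℕ)) • e (i.castLE (by norm_num)))) : V)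
        (k.castLE (by norm_num)) = s * (-1) ^ (ν k : ℕ) / 2) ∧
    (s • ((1 / 2 : ℝ) • (e 7 - e 6 - e 5 +
      ∑ i : Fin 5, ((-1 : ℝ) ^ (ν i : ℕ)) • e (i.castLE (by norm_num)))) : V) 5 = -s / 2 ∧
    (s • ((1 / 2 : ℝ) • (e 7 - e 6 - e 5 +
      ∑ i : Fin 5, ((-1 : ℝ) ^ (ν i : ℕ)) • e (i.castLE (by norm_num)))) : V) 6 = -s / 2 ∧
    (s • ((1 / 2 : ℝ) • (e 7 - e 6 - e 5 +
      ∑ i : Fin 5, ((-1 : ℝ) ^ (ν i : ℕ)) • e (i.castLE (by norm_num)))) : V) 7 = s / 2 := by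
  refine ⟨fun k => ?_, ?_, ?_, ?_⟩
  · fin_cases k <;> simp [Fin.sum_univ_five, e] <;> ring
  all_goals
    simp [Fin.sum_univ_five, e]
    ring

theorem exists_hasLabels_of_mem_rootsSpin {v : V} (hv : v ∈ rootsSpin) :
    ∃ n, HasLabels v n ∧ 3 ∣ labelClass n := by
  obtain ⟨ν, hν, s, hs, rfl⟩ := hv
  obtain ⟨h, h5, h6, h7⟩ := rootsSpin_coord ν s
  obtain ⟨s', rfl, hs'⟩ : ∃ s' : ℤ, s = s' ∧ (s' = 1 ∨ s' = -1) := by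
    rcases hs with rfl | rfl
    · exact ⟨1, by simp, by simp⟩
    · exact ⟨-1, by simp, by simp⟩
  have hpow : ∀ k : Fin 2, (-1 : ℝ) ^ (k : ℕ) = 1 - 2 * (k : ℕ) := by
    intro k; fin_cases k <;> norm_num
  refine exists_hasLabels_of_half (fun k => s' * (1 - 2 * (ν k : ℕ))) s' ?_ ?_ ?_ ?_ ?_ h5 h6 h7
    ?_ ?_
  · exact (h 0).trans (by rw [hpow]; push_cast; rfl)
  · exact (h 1).trans (by rw [hpow]; push_cast; rfl)
  · exact (h 2).trans (by rw [hpow]; push_cast; rfl)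
  · exact (h 3).trans (by rw [hpow]; push_cast; rfl)
  · exact (h 4).trans (by rw [hpow]; push_cast; rfl)
  · intro k
    exact ⟨-(s' * (ν k : ℕ)), by ring⟩
  · rw [Fin.sum_univ_five] at hν
    obtain ⟨m, hm⟩ := hν
    rcases hs' with rfl | rfl <;> omega

theorem simpleRoot_mem_roots (i : Fin 6) : simpleRoot i ∈ roots := by
  have hD : ∀ (i j : Fin 5), i < j →
      e (j.castLE (by norm_num)) - e (i.castLE (by norm_num)) ∈ roots := by
    intro i j hij
    refine Or.inl ⟨i, j, hij, -1, 1, Or.inr rfl, Or.inl rfl, ?_⟩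
    rw [neg_one_smul, one_smul]; abel
  fin_cases i
  · refine Or.inr ⟨![0, 1, 1, 1, 1], by decide, 1, Or.inl rfl, ?_⟩
    ext k
    fin_cases k <;> simp [simpleRoot, e, Fin.sum_univ_five]
  · refine Or.inl ⟨0, 1, by decide, 1, 1, Or.inl rfl, Or.inl rfl, ?_⟩
    rw [one_smul, one_smul]; rfl
  · exact hD 0 1 (by decide)
  · exact hD 1 2 (by decide)
  · exact hD 2 3 (by decide)
  · exact hD 3 4 (by decide)

/-- The coefficients are given by the inverse Cartan matrix, whose rows for α₁, α₃, α₅, α₆ have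
denominator 3. Substituting `3 * m` for the class of `n` clears these denominators. -/
theorem HasLabels.eq_sum_simpleRoot {v : V} {n : Fin 6 → ℤ} (h : HasLabels v n)
    (hn : 3 ∣ labelClass n) : ∃ c : Fin 6 → ℤ, v = ∑ j, c j • simpleRoot j := by
  obtain ⟨m, hm⟩ := hn
  rw [labelClass] at hm
  have hm' : (n 0 + 2 * n 2 + n 4 + 2 * n 5 : ℝ) = 3 * m := by exact_mod_cast hm
  obtain ⟨h0, h1, h2, h3, h4, h5⟩ := inner_weight v
  obtain ⟨e1, e2⟩ := mem_E.1 h.1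
  obtain ⟨l0, l1, l2, l3, l4, l5⟩ := inner_simpleRoot v
  rw [h.2] at l0 l1 l2 l3 l4 l5
  refine ⟨![m + n 0 + n 1 + n 2 + 2 * n 3 + n 4,
    n 0 + 2 * n 1 + 2 * n 2 + 3 * n 3 + 2 * n 4 + n 5,
    2 * m + n 0 + 2 * n 1 + 2 * n 2 + 4 * n 3 + 2 * n 4,
    2 * n 0 + 3 * n 1 + 4 * n 2 + 6 * n 3 + 4 * n 4 + 2 * n 5,
    m + n 0 + 2 * n 1 + 2 * n 2 + 4 * n 3 + 3 * n 4 + n 5,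
    2 * m + n 1 + 2 * n 3 + n 4], ?_⟩
  conv_lhs => rw [RootE6.eq_sum_simpleRoot h.1]
  refine Finset.sum_congr rfl fun j _ => ?_
  rw [← Int.cast_smul_eq_zsmul ℝ]
  congr 1
  fin_cases j
  · refine h0.trans ?_
    simp
    linarith
  · refine h1.trans ?_
    simp
    linarith
  · refine h2.trans ?_
    simp
    linarith
  · refine h3.trans ?_
    simp
    linarith
  · refine h4.trans ?_
    simp
    linarith
  · refine h5.trans ?_
    simp
    linarith

theorem mem_rootLattice {v : V} : v ∈ rootLattice ↔ ∃ n, HasLabels v n ∧ 3 ∣ labelClass n := by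
  constructor
  · intro hv
    induction hv using AddSubgroup.closure_induction with
    | mem v hv =>
      rcases hv with hv | hv
      · exact exists_hasLabels_of_mem_rootsD hv
      · exact exists_hasLabels_of_mem_rootsSpin hv
    | zero => exact ⟨0, hasLabels_zero, by simp [labelClass]⟩
    | add v w _ _ h1 h2 =>
      obtain ⟨n, hn, hn'⟩ := h1
      obtain ⟨m, hm, hm'⟩ := h2
      exact ⟨n + m, hn.add hm, by rw [labelClass_add]; exact dvd_add hn' hm'⟩
    | neg v _ h1 =>
      obtain ⟨n, hn, hn'⟩ := h1
      exact ⟨-n, hn.neg, by rw [labelClass_neg]; exact hn'.neg_right⟩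
  · rintro ⟨n, hn, hn'⟩
    obtain ⟨c, hc⟩ := hn.eq_sum_simpleRoot hn'
    rw [hc]
    exact sum_mem fun j _ => zsmul_mem (AddSubgroup.subset_closure (simpleRoot_mem_roots j)) _

theorem HasLabels.mem_rootLattice_iff {v : V} {n : Fin 6 → ℤ} (h : HasLabels v n) :
    v ∈ rootLattice ↔ 3 ∣ labelClass n := by
  rw [mem_rootLattice]
  constructor
  · rintro ⟨m, hm, hm'⟩
    rwa [h.unique hm]
  · exact fun hn => ⟨n, h, hn⟩

theorem root_mem_E {α : V} (hα : α ∈ roots) : α ∈ E := by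
  obtain ⟨n, hn, -⟩ := mem_rootLattice.1 (AddSubgroup.subset_closure hα)
  exact hn.1

theorem HasLabels.inner_root {v α : V} {n : Fin 6 → ℤ} (h : HasLabels v n) (hα : α ∈ roots) :
    ∃ m : ℤ, inner ℝ v α = (m : ℝ) := by
  obtain ⟨k, hk, hk'⟩ := mem_rootLattice.1 (AddSubgroup.subset_closure hα)
  obtain ⟨c, hc⟩ := hk.eq_sum_simpleRoot hk'
  refine ⟨∑ j, c j * n j, ?_⟩
  rw [hc, inner_sum]
  push_cast
  refine Finset.sum_congr rfl fun j _ => ?_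
  rw [← Int.cast_smul_eq_zsmul ℝ, inner_smul_right, h.2]

theorem inner_root_self {α : V} (hα : α ∈ roots) : inner ℝ α α = (2 : ℝ) := by
  rcases hα with hα | hα
  · obtain ⟨i, j, hij, s, t, hs, ht, rfl⟩ := hα
    have h1 : i ≠ j := hij.ne
    have h2 : s * s = 1 := by rcases hs with rfl | rfl <;> norm_num
    have h3 : t * t = 1 := by rcases ht with rfl | rfl <;> norm_num
    simp only [inner_add_left, inner_add_right, inner_smul_left, inner_smul_right, e]
    simp [h1, h1.symm, EuclideanSpace.inner_single_right]
    linarith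
  · obtain ⟨ν, hν, s, hs, rfl⟩ := hα
    obtain ⟨h, h5, h6, h7⟩ := rootsSpin_coord ν s
    have hpow : ∀ k : Fin 5,
        s * (-1 : ℝ) ^ (ν k : ℕ) / 2 * (s * (-1 : ℝ) ^ (ν k : ℕ) / 2) = 1 / 4 := by
      intro k
      have h1 : s * s = 1 := by rcases hs with rfl | rfl <;> norm_num
      have h2 : (-1 : ℝ) ^ (ν k : ℕ) * (-1 : ℝ) ^ (ν k : ℕ) = 1 := by
        rw [← mul_pow]; norm_num
      linear_combination h1 * ((-1 : ℝ) ^ (ν k : ℕ) * (-1 : ℝ) ^ (ν k : ℕ)) / 4 + h2 / 4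
    have h1 : s * s = 1 := by rcases hs with rfl | rfl <;> norm_num
    rw [PiLp.inner_apply, Fin.sum_univ_eight]
    simp only [RCLike.inner_apply, conj_trivial]
    rw [h5, h6, h7]
    have e0 := h 0
    have e1 := h 1
    have e2 := h 2
    have e3 := h 3
    have e4 := h 4
    simp only [Fin.castLE_zero] at e0
    erw [e0, e1, e2, e3, e4]
    rw [hpow, hpow, hpow, hpow, hpow]
    linear_combination 3 / 4 * h1

theorem reflection_root_apply {α : V} (hα : α ∈ roots) (v : V) :
    (Submodule.span ℝ {α})ᗮ.reflection v = v - inner ℝ v α • α := by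
  have h2 : ‖α‖ ^ 2 = 2 := by rw [← real_inner_self_eq_norm_sq, inner_root_self hα]
  rw [Submodule.reflection_orthogonal_apply, Submodule.reflection_singleton_apply]
  change -((2 : ℕ) • (inner ℝ α v / ‖α‖ ^ 2) • α - v) = _
  rw [h2, real_inner_comm, two_smul, ← add_smul, add_halves, neg_sub]

/-- The simple reflections, as elements of the Weyl group. -/
theorem exists_simpleReflection (i : Fin 6) :
    ∃ s ∈ weylGroup, ∀ v, s v = v - inner ℝ v (simpleRoot i) • simpleRoot i :=
  ⟨(Submodule.span ℝ {simpleRoot i})ᗮ.reflection,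
    Subgroup.subset_closure ⟨_, simpleRoot_mem_roots i, rfl⟩,
    reflection_root_apply (simpleRoot_mem_roots i)⟩

/-- A reflection moves an integral weight by an integer multiple of its root. The image is again an
integral weight, so the induction over products continues. -/
theorem weyl_apply_sub_mem {w : V ≃ₗᵢ[ℝ] V} (hw : w ∈ weylGroup) {v : V} {n : Fin 6 → ℤ}
    (hv : HasLabels v n) : w v - v ∈ rootLattice := by
  have key : ∀ α ∈ roots, ∀ (v : V) (n : Fin 6 → ℤ), HasLabels v n →
      (Submodule.span ℝ {α})ᗮ.reflection v - v ∈ rootLattice := by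
    intro α hα v n hv
    obtain ⟨m, hm⟩ := hv.inner_root hα
    rw [reflection_root_apply hα, hm, sub_sub_cancel_left, Int.cast_smul_eq_zsmul]
    exact neg_mem (zsmul_mem (AddSubgroup.subset_closure hα) _)
  induction hw using Subgroup.closure_induction'' generalizing v n with
  | mem g hg =>
    obtain ⟨α, hα, rfl⟩ := hg
    exact key α hα v n hv
  | inv_mem g hg =>
    obtain ⟨α, hα, rfl⟩ := hg
    rw [Submodule.reflection_inv]
    exact key α hα v n hv
  | one => simp
  | mul g g' _ _ h h' =>
    have h1 := h' hv
    obtain ⟨m, hm, -⟩ := mem_rootLattice.1 h1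
    have h2 : HasLabels (g' v) (m + n) := by simpa using hm.add hv
    have h3 := add_mem (h h2) h1
    rwa [sub_add_sub_cancel] at h3

theorem weyl_apply_eq_self {w : V ≃ₗᵢ[ℝ] V} (hw : w ∈ weylGroup) {v : V}
    (hv : v ∈ Eᗮ) : w v = v := by
  have key : ∀ α ∈ roots, (Submodule.span ℝ {α})ᗮ.reflection v = v := by
    intro α hα
    rw [reflection_root_apply hα, Submodule.inner_left_of_mem_orthogonal (root_mem_E hα) hv,
      zero_smul, sub_zero]
  induction hw using Subgroup.closure_induction'' with
  | mem g hg =>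
    obtain ⟨α, hα, rfl⟩ := hg
    exact key α hα
  | inv_mem g hg =>
    obtain ⟨α, hα, rfl⟩ := hg
    rw [Submodule.reflection_inv]
    exact key α hα
  | one => simp
  | mul g g' _ _ h h' => rw [LinearIsometryEquiv.coe_mul, Function.comp_apply, h', h]

theorem finite_norm_two : {v : V | v ∈ rootLattice ∧ inner ℝ v v = (2 : ℝ)}.Finite := by
  refine ((Set.finite_Icc (fun _ : Fin 6 => (-2 : ℤ)) (fun _ => 2)).image
    fun n => ∑ j, (n j : ℝ) • weight j).subset ?_
  rintro v ⟨hv, hv2⟩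
  obtain ⟨n, hn, -⟩ := mem_rootLattice.1 hv
  have hle : ∀ j, |(n j : ℝ)| ≤ 2 := by
    intro j
    have h := abs_real_inner_le_norm v (simpleRoot j)
    have h1 := real_inner_self_eq_norm_sq v
    have h2 := real_inner_self_eq_norm_sq (simpleRoot j)
    rw [inner_simpleRoot_self] at h2
    rw [hv2] at h1
    rw [hn.2] at h
    -- By Cauchy–Schwarz the label is at most ‖v‖‖α‖ ≤ (‖v‖² + ‖α‖²)/2 = 2 in absolute value.
    nlinarith [norm_nonneg v, norm_nonneg (simpleRoot j), sq_nonneg (‖v‖ - ‖simpleRoot j‖)]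
  refine ⟨n, ⟨fun j => ?_, fun j => ?_⟩, hn.eq_sum.symm⟩
  · exact_mod_cast (abs_le.1 (hle j)).1
  · exact_mod_cast (abs_le.1 (hle j)).2

/-- An element is determined by the images of the six simple roots, since it is trivial on the
complement of `E`. These images lie in the finite set of lattice vectors of squared norm 2. -/
theorem finite_weylGroup : Finite weylGroup := by
  have := finite_norm_two.to_subtype
  have hmem : ∀ (w : weylGroup) (i : Fin 6), w.1 (simpleRoot i) ∈
      {v : V | v ∈ rootLattice ∧ inner ℝ v v = (2 : ℝ)} := by
    intro w i
    have h0 : simpleRoot i ∈ rootLattice := AddSubgroup.subset_closure (simpleRoot_mem_roots i)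
    obtain ⟨n, hn, -⟩ := mem_rootLattice.1 h0
    refine ⟨?_, ?_⟩
    · simpa using add_mem (weyl_apply_sub_mem w.2 hn) h0
    · rw [LinearIsometryEquiv.inner_map_map, inner_simpleRoot_self]
  refine Finite.of_injective (fun w i => (⟨_, hmem w i⟩ :
    {v : V | v ∈ rootLattice ∧ inner ℝ v v = (2 : ℝ)}) : weylGroup → Fin 6 → _) ?_
  intro w w' h
  ext1
  refine LinearIsometryEquiv.ext fun v => ?_
  obtain ⟨a, ha, b, hb, rfl⟩ := E.exists_add_mem_mem_orthogonal v
  have hs : ∀ i, w.1 (simpleRoot i) = w'.1 (simpleRoot i) := fun i =>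
    congrArg Subtype.val (congrFun h i)
  rw [map_add, map_add, weyl_apply_eq_self w.2 hb, weyl_apply_eq_self w'.2 hb,
    eq_sum_simpleRoot ha, map_sum, map_sum]
  simp only [map_smul, hs]

/-! ### Height and norm of weights, and the maximal vector of an orbit -/

/-- The half sum of the positive roots, that is, the sum of the fundamental weights. -/
noncomputable def rho : V := ∑ i, weight i

/-- The height function `v ↦ (v, ρ)`. -/
noncomputable def height : V →ₗ[ℝ] ℝ := (innerₗ V).flip rho

theorem height_apply (v : V) : height v = inner ℝ v rho := rfl

theorem height_simpleRoot (i : Fin 6) : height (simpleRoot i) = 1 := by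
  rw [height_apply, rho, inner_sum]
  simp_rw [real_inner_comm _ (simpleRoot i), inner_weight_simpleRoot]
  simp

theorem HasLabels.inner_weight {v : V} {n : Fin 6 → ℤ} (h : HasLabels v n) :
    inner ℝ v (weight 0) = (4 * n 0 + 3 * n 1 + 5 * n 2 + 6 * n 3 + 4 * n 4 + 2 * n 5 : ℝ) / 3 ∧
    inner ℝ v (weight 1) = (n 0 + 2 * n 1 + 2 * n 2 + 3 * n 3 + 2 * n 4 + n 5 : ℝ) ∧
    inner ℝ v (weight 2) = (5 * n 0 + 6 * n 1 + 10 * n 2 + 12 * n 3 + 8 * n 4 + 4 * n 5 : ℝ) / 3 ∧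
    inner ℝ v (weight 3) = (2 * n 0 + 3 * n 1 + 4 * n 2 + 6 * n 3 + 4 * n 4 + 2 * n 5 : ℝ) ∧
    inner ℝ v (weight 4) = (4 * n 0 + 6 * n 1 + 8 * n 2 + 12 * n 3 + 10 * n 4 + 5 * n 5 : ℝ) / 3 ∧
    inner ℝ v (weight 5) = (2 * n 0 + 3 * n 1 + 4 * n 2 + 6 * n 3 + 5 * n 4 + 4 * n 5 : ℝ) / 3 := by
  obtain ⟨h0, h1, h2, h3, h4, h5⟩ := RootE6.inner_weight v
  obtain ⟨e1, e2⟩ := mem_E.1 h.1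
  obtain ⟨l0, l1, l2, l3, l4, l5⟩ := inner_simpleRoot v
  rw [h.2] at l0 l1 l2 l3 l4 l5
  rw [h0, h1, h2, h3, h4, h5]
  refine ⟨?_, ?_, ?_, ?_, ?_, ?_⟩ <;> linarith

/-- The height in terms of the coordinates of a weight. -/
def labelHeight (n : Fin 6 → ℤ) : ℤ :=
  8 * n 0 + 11 * n 1 + 15 * n 2 + 21 * n 3 + 15 * n 4 + 8 * n 5

theorem HasLabels.height_eq {v : V} {n : Fin 6 → ℤ} (h : HasLabels v n) :
    height v = (labelHeight n : ℝ) := by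
  obtain ⟨h0, h1, h2, h3, h4, h5⟩ := h.inner_weight
  rw [height_apply, rho, inner_sum, Fin.sum_univ_six, h0, h1, h2, h3, h4, h5, labelHeight]
  push_cast
  ring

/-- Three times the squared norm in terms of the coordinates of a weight. -/
def labelNorm (n : Fin 6 → ℤ) : ℤ :=
  n 0 * (4 * n 0 + 3 * n 1 + 5 * n 2 + 6 * n 3 + 4 * n 4 + 2 * n 5) +
  n 1 * (3 * n 0 + 6 * n 1 + 6 * n 2 + 9 * n 3 + 6 * n 4 + 3 * n 5) +
  n 2 * (5 * n 0 + 6 * n 1 + 10 * n 2 + 12 * n 3 + 8 * n 4 + 4 * n 5) +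
  n 3 * (6 * n 0 + 9 * n 1 + 12 * n 2 + 18 * n 3 + 12 * n 4 + 6 * n 5) +
  n 4 * (4 * n 0 + 6 * n 1 + 8 * n 2 + 12 * n 3 + 10 * n 4 + 5 * n 5) +
  n 5 * (2 * n 0 + 3 * n 1 + 4 * n 2 + 6 * n 3 + 5 * n 4 + 4 * n 5)

theorem HasLabels.inner_self {v : V} {n : Fin 6 → ℤ} (h : HasLabels v n) :
    3 * inner ℝ v v = (labelNorm n : ℝ) := by
  obtain ⟨h0, h1, h2, h3, h4, h5⟩ := h.inner_weight
  have : inner ℝ v v = ∑ j, (n j : ℝ) * inner ℝ v (weight j) := by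
    conv_lhs => rw [h.eq_sum, inner_sum]
    refine Finset.sum_congr rfl fun j _ => ?_
    rw [inner_smul_right, ← h.eq_sum]
  rw [this, Fin.sum_univ_six, h0, h1, h2, h3, h4, h5, labelNorm]
  push_cast
  ring

/-- Norm and class single out ϖ_i among dominant weights. The class is needed: ϖ₁ and ϖ₆ have equal
norm, as do ϖ₃ and ϖ₅. -/
theorem eq_single_of_labelNorm_eq {n : Fin 6 → ℤ} (hn : ∀ j, 0 ≤ n j) (i : Fin 6)
    (hnorm : labelNorm n = labelNorm (Pi.single i 1))
    (hclass : 3 ∣ labelClass n - labelClass (Pi.single i 1)) : n = Pi.single i 1 := by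
  have hi : ∀ i : Fin 6, labelNorm (Pi.single i 1) ≤ 18 := by decide +kernel
  have key : ∀ a b c d f g : Fin 3, ∀ i : Fin 6,
      labelNorm ![(a : ℤ), b, c, d, f, g] = labelNorm (Pi.single i 1) →
      3 ∣ labelClass ![(a : ℤ), b, c, d, f, g] - labelClass (Pi.single i 1) →
      ∀ j, (![(a : ℤ), b, c, d, f, g] : Fin 6 → ℤ) j = (Pi.single i 1 : Fin 6 → ℤ) j := by
    decide +kernel
  -- All coefficients of `labelNorm` are nonnegative and the diagonal ones are at least 4, so `4 * n
  -- j ^ 2 ≤ 18`. This leaves the finite box checked in `key`.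
  have hlt : ∀ j, n j < 3 := by
    have hle := hi i
    rw [← hnorm, labelNorm] at hle
    have p : ∀ a b, 0 ≤ n a * n b := fun a b => mul_nonneg (hn a) (hn b)
    have hsq : ∀ j, 4 * (n j * n j) ≤ 18 := by
      have h : 4 * (n 0 * n 0) ≤ 18 ∧ 4 * (n 1 * n 1) ≤ 18 ∧ 4 * (n 2 * n 2) ≤ 18 ∧
          4 * (n 3 * n 3) ≤ 18 ∧ 4 * (n 4 * n 4) ≤ 18 ∧ 4 * (n 5 * n 5) ≤ 18 := by
        refine ⟨?_, ?_, ?_, ?_, ?_, ?_⟩ <;>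
        linarith [p 0 0, p 0 1, p 0 2, p 0 3, p 0 4, p 0 5,
          p 1 1, p 1 2, p 1 3, p 1 4, p 1 5,
           p 2 2, p 2 3, p 2 4, p 2 5, p 3 3, p 3 4, p 3 5, p 4 4, p 4 5, p 5 5]
      obtain ⟨h0, h1, h2, h3, h4, h5⟩ := h
      intro j
      fin_cases j <;> assumption
    intro j
    nlinarith [hsq j, hn j]
  have hf : ∀ j, ∃ m : Fin 3, n j = (m : ℕ) := fun j =>
    ⟨⟨(n j).toNat, by have := hlt j; have := hn j; omega⟩, by
      have := hn j
      simp [Int.toNat_of_nonneg this]⟩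
  choose m hm using hf
  have hnm : n = ![(m 0 : ℤ), m 1, m 2, m 3, m 4, m 5] := by
    ext j
    rw [hm]
    fin_cases j <;> rfl
  rw [hnm] at hnorm hclass ⊢
  exact funext (key _ _ _ _ _ _ i hnorm hclass)

/-- The vector `ϖ_i` is the only vector of maximal height in its Weyl group orbit. -/
theorem weylOrbit_weight {i : Fin 6} {u : V} (hu : u ∈ weylOrbit (weight i)) :
    u - weight i ∈ rootLattice ∧ (u = weight i ∨ height u < height (weight i)) := by
  have hmem : ∀ u ∈ weylOrbit (weight i), u - weight i ∈ rootLattice := by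
    rintro _ ⟨w, hw, rfl⟩
    exact weyl_apply_sub_mem hw (hasLabels_weight i)
  have hfin : (weylOrbit (weight i)).Finite := by
    have := finite_weylGroup
    refine (Set.finite_range fun w : weylGroup => w.1 (weight i)).subset ?_
    rintro _ ⟨w, hw, rfl⟩
    exact ⟨⟨w, hw⟩, rfl⟩
  have hmax : ∀ u ∈ weylOrbit (weight i), (∀ u' ∈ weylOrbit (weight i), height u' ≤ height u) →
      u = weight i := by
    intro u hu hmax
    obtain ⟨m, hm, hm'⟩ := mem_rootLattice.1 (hmem u hu)
    have hlab : HasLabels u (m + Pi.single i 1) := by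
      simpa using hm.add (hasLabels_weight i)
    have hnorm : inner ℝ u u = inner ℝ (weight i) (weight i) := by
      obtain ⟨w, hw, rfl⟩ := hu
      rw [LinearIsometryEquiv.inner_map_map]
    -- The j-th simple reflection lowers the height by exactly the j-th label, so maximality forces
    -- that label to be nonnegative.
    have hnn : ∀ j, 0 ≤ (m + Pi.single i 1 : Fin 6 → ℤ) j := by
      intro j
      obtain ⟨w, hw, rfl⟩ := hu
      obtain ⟨s, hs, hs'⟩ := exists_simpleReflection j
      have h1 := hmax (s (w (weight i))) ⟨s * w, mul_mem hs hw, rfl⟩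
      rw [hs', map_sub, map_smul, height_simpleRoot, hlab.2, smul_eq_mul, mul_one] at h1
      have : (0 : ℝ) ≤ ((m + Pi.single i 1 : Fin 6 → ℤ) j : ℝ) := by linarith
      exact_mod_cast this
    have h3 := eq_single_of_labelNorm_eq hnn i (by
      have h1 := hlab.inner_self
      have h2 := (hasLabels_weight i).inner_self
      rw [hnorm, h2] at h1
      exact_mod_cast h1.symm) (by rwa [labelClass_add, add_sub_cancel_right])
    rw [h3] at hlab
    rw [hlab.eq_sum, ← (hasLabels_weight i).eq_sum]
  refine ⟨hmem u hu, ?_⟩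
  -- The finite orbit has a vector of maximal height, which must be ϖ_i. A vector of the same height
  -- would be maximal too, hence equal to ϖ_i.
  obtain ⟨u0, hu0, hu0'⟩ := hfin.exists_maximalFor height _ ⟨u, hu⟩
  have hu1 : ∀ u' ∈ weylOrbit (weight i), height u' ≤ height u0 := fun u' hu' =>
    (le_total (height u') (height u0)).elim id (hu0' hu')
  have hu2 := hmax u0 hu0 hu1
  rw [hu2] at hu1
  rcases (hu1 u hu).lt_or_eq with h | h
  · exact Or.inr h
  · exact Or.inl (hmax u hu fun u' hu' => h ▸ hu1 u' hu')

open AddMonoidAlgebra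

/-! ### Dominant weights -/

/-- The map `l ↦ ∑ l_i ϖ_i`. -/
noncomputable def weightSum : (Fin 6 → ℕ) →+ V where
  toFun l := ∑ i, l i • weight i
  map_zero' := by simp
  map_add' l m := by simp [add_smul, Finset.sum_add_distrib]

theorem weightSum_apply (l : Fin 6 → ℕ) : weightSum l = ∑ i, l i • weight i := rfl

theorem hasLabels_weightSum (l : Fin 6 → ℕ) : HasLabels (weightSum l) (fun i => l i) := by
  have h := hasLabels_sum (fun i => (l i : ℤ))
  rw [weightSum_apply]
  convert h using 2 with i
  rw [← Nat.cast_smul_eq_nsmul ℝ]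
  simp

theorem weightSum_injective : Function.Injective weightSum := by
  intro l m h
  have h1 := hasLabels_weightSum l
  rw [h] at h1
  have h2 := h1.unique (hasLabels_weightSum m)
  ext i
  exact_mod_cast congrFun h2 i

theorem weightSum_mem_rootLattice {l : Fin 6 → ℕ} :
    weightSum l ∈ rootLattice ↔ l ∈ coordMonoid := by
  rw [(hasLabels_weightSum l).mem_rootLattice_iff, mem_coordMonoid, labelClass]
  omega

theorem mrange_weightSum : AddMonoidHom.mrange weightSum = dominantWeights := by
  refine le_antisymm ?_ (AddSubmonoid.closure_le.2 ?_)
  · rintro _ ⟨l, rfl⟩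
    have h : ∀ i, weight i ∈ dominantWeights := fun i => AddSubmonoid.subset_closure ⟨i, rfl⟩
    rw [weightSum_apply]
    exact sum_mem fun i _ => nsmul_mem (h i) _
  · rintro _ ⟨i, rfl⟩
    refine ⟨Pi.single i 1, ?_⟩
    rw [weightSum_apply, Finset.sum_eq_single i]
    · simp
    · intro j _ hj
      simp [hj]
    · simp

theorem map_weightSum : coordMonoid.map weightSum = M := by
  ext v
  rw [M, ← mrange_weightSum]
  constructor
  · rintro ⟨l, hl, rfl⟩
    exact ⟨⟨l, rfl⟩, weightSum_mem_rootLattice.2 hl⟩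
  · rintro ⟨⟨l, rfl⟩, hl⟩
    exact ⟨l, weightSum_mem_rootLattice.1 hl, rfl⟩

/-- The isomorphism from the monoid of coordinate vectors to `M`. -/
noncomputable def coordEquiv : coordMonoid ≃+ M :=
  (coordMonoid.equivMapOfInjective weightSum weightSum_injective).trans
    (AddEquiv.addSubmonoidCongr map_weightSum)

/-! ### Leading terms -/

theorem coeff_mul_ne_zero {f g : GroupAlg} {u : V} (h : (f * g).coeff u ≠ 0) :
    ∃ a b, f.coeff a ≠ 0 ∧ g.coeff b ≠ 0 ∧ a + b = u := by
  classical
  have := support_coeff_mul_subset f g (Finsupp.mem_support_iff.2 h)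
  obtain ⟨a, ha, b, hb, hab⟩ := Finset.mem_add.1 this
  exact ⟨a, b, Finsupp.mem_support_iff.1 ha, Finsupp.mem_support_iff.1 hb, hab⟩

/-- `f` is the sum of `x^v` and of terms `x^u` of smaller height, with `u` congruent to `v`
modulo the root lattice. -/
def Lead (f : GroupAlg) (v : V) : Prop :=
  ∀ u, (f - single v 1).coeff u ≠ 0 → u - v ∈ rootLattice ∧ height u < height v

theorem Lead.mul {f g : GroupAlg} {v w : V} (hf : Lead f v) (hg : Lead g w) :
    Lead (f * g) (v + w) := by
  intro u hu
  have e : f * g - single (v + w) 1 = (f - single v 1) * (g - single w 1) +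
      ((f - single v 1) * single w 1 + single v 1 * (g - single w 1)) := by
    have : (single (v + w) 1 : GroupAlg) = single v 1 * single w 1 := by
      rw [single_mul_single, mul_one]
    rw [this]
    ring
  have hs : ∀ v a : V, (single v 1 : GroupAlg).coeff a ≠ 0 → a = v := by
    intro v a ha
    by_contra hne
    exact ha (by rw [coeff_single, Finsupp.single_eq_of_ne hne])
  have hor : ((f - single v 1) * (g - single w 1)).coeff u ≠ 0 ∨
      ((f - single v 1) * single w 1).coeff u ≠ 0 ∨
      (single v 1 * (g - single w 1)).coeff u ≠ 0 := by
    by_contra! hcon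
    apply hu
    rw [e, coeff_add, coeff_add, Finsupp.add_apply, Finsupp.add_apply, hcon.1, hcon.2.1,
      hcon.2.2]
    simp
  rcases hor with h | h | h
  · obtain ⟨a, b, ha, hb, rfl⟩ := coeff_mul_ne_zero h
    obtain ⟨h1, h2⟩ := hf a ha
    obtain ⟨h3, h4⟩ := hg b hb
    rw [map_add, map_add, add_sub_add_comm]
    exact ⟨add_mem h1 h3, add_lt_add h2 h4⟩
  · obtain ⟨a, b, ha, hb, rfl⟩ := coeff_mul_ne_zero h
    obtain ⟨h1, h2⟩ := hf a ha
    obtain rfl := hs w b hb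
    rw [map_add, map_add, add_sub_add_right_eq_sub]
    exact ⟨h1, add_lt_add_left h2 _⟩
  · obtain ⟨a, b, ha, hb, rfl⟩ := coeff_mul_ne_zero h
    obtain ⟨h1, h2⟩ := hg b hb
    obtain rfl := hs v a ha
    rw [map_add, map_add, add_sub_add_left_eq_sub]
    exact ⟨h1, add_lt_add_right h2 _⟩

theorem lead_one : Lead 1 0 := by
  intro u hu
  rw [one_def, sub_self] at hu
  exact absurd rfl hu

theorem Lead.pow {f : GroupAlg} {v : V} (hf : Lead f v) (n : ℕ) : Lead (f ^ n) (n • v) := by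
  induction n with
  | zero => simpa using lead_one
  | succ n ih => rw [pow_succ, succ_nsmul]; exact ih.mul hf

theorem Lead.coeff_self {f : GroupAlg} {v : V} (hf : Lead f v) : f.coeff v = 1 := by
  by_contra h
  refine lt_irrefl _ (hf v ?_).2
  rw [coeff_sub, Finsupp.sub_apply, coeff_single, Finsupp.single_eq_same]
  exact sub_ne_zero.2 h

theorem Lead.of_coeff_ne_zero {f : GroupAlg} {v u : V} (hf : Lead f v) (hu : f.coeff u ≠ 0)
    (huv : u ≠ v) : u - v ∈ rootLattice ∧ height u < height v := by
  refine hf u ?_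
  rwa [coeff_sub, Finsupp.sub_apply, coeff_single, Finsupp.single_eq_of_ne huv, sub_zero]

open Classical in
theorem coeff_orbitSum (v u : V) :
    (orbitSum v).coeff u = if u ∈ weylOrbit v then 1 else 0 := by
  have hfin : (weylOrbit v).Finite := by
    have := finite_weylGroup
    refine (Set.finite_range fun w : weylGroup => w.1 v).subset ?_
    rintro _ ⟨w, hw, rfl⟩
    exact ⟨⟨w, hw⟩, rfl⟩
  rw [orbitSum, finsum_mem_eq_finite_toFinset_sum _ hfin, coeff_sum, Finsupp.finsetSum_apply]
  simp [Finsupp.single_apply]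

theorem lead_orbitSum (i : Fin 6) : Lead (orbitSum (weight i)) (weight i) := by
  classical
  intro u hu
  rw [coeff_sub, Finsupp.sub_apply, coeff_single, coeff_orbitSum] at hu
  by_cases h : u = weight i
  · subst h
    rw [if_pos ⟨1, one_mem _, rfl⟩, Finsupp.single_eq_same] at hu
    simp at hu
  · rw [Finsupp.single_eq_of_ne h, sub_zero] at hu
    have hmem : u ∈ weylOrbit (weight i) := by
      by_contra hc
      exact hu (if_neg hc)
    obtain ⟨h1, h2⟩ := weylOrbit_weight hmem
    exact ⟨h1, h2.resolve_left h⟩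

/-- The monomials in the six orbit sums. -/
noncomputable def orbitMonomial (l : Fin 6 → ℕ) : GroupAlg := ∏ i, orbitSum (weight i) ^ l i

theorem orbitMonomial_zero : orbitMonomial 0 = 1 := by simp [orbitMonomial]

theorem orbitMonomial_add (l m : Fin 6 → ℕ) :
    orbitMonomial (l + m) = orbitMonomial l * orbitMonomial m := by
  simp [orbitMonomial, pow_add, Finset.prod_mul_distrib]

theorem lead_orbitMonomial (l : Fin 6 → ℕ) : Lead (orbitMonomial l) (weightSum l) := by
  rw [orbitMonomial, weightSum_apply, Fin.prod_univ_six, Fin.sum_univ_six]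
  exact ((((((lead_orbitSum 0).pow _).mul ((lead_orbitSum 1).pow _)).mul
    ((lead_orbitSum 2).pow _)).mul ((lead_orbitSum 3).pow _)).mul
    ((lead_orbitSum 4).pow _)).mul ((lead_orbitSum 5).pow _)

/-- In a vanishing combination, compare coefficients at a leading exponent of maximal height among
the terms that occur. -/
theorem linearIndependent_orbitMonomial : LinearIndependent ℤ orbitMonomial := by
  classical
  rw [linearIndependent_iff']
  intro s g hg
  by_contra! hcon
  obtain ⟨l0, hl0, hgl0⟩ := hcon
  obtain ⟨l, hl, hmax⟩ := (s.filter fun l => g l ≠ 0).exists_max_image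
    (fun l => height (weightSum l)) ⟨l0, Finset.mem_filter.2 ⟨hl0, hgl0⟩⟩
  obtain ⟨hls, hgl⟩ := Finset.mem_filter.1 hl
  apply hgl
  have h := congrArg (fun f : GroupAlg => f.coeff (weightSum l)) hg
  simp only [coeff_sum, Finsupp.finsetSum_apply, coeff_smul_apply, coeff_zero,
    Finsupp.zero_apply] at h
  rw [Finset.sum_eq_single_of_mem l hls, (lead_orbitMonomial l).coeff_self, smul_eq_mul,
    mul_one] at h
  · exact h
  · intro m hm hml
    by_cases hgm : g m = 0
    · rw [hgm, zero_smul]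
    -- Heights may tie, but below its leading exponent a monomial has only strictly lower ones. So
    -- x^{weightSum l} cannot occur in a different monomial of no greater height.
    · suffices (orbitMonomial m).coeff (weightSum l) = 0 by rw [this, smul_zero]
      by_contra hne
      exact not_lt_of_ge (hmax m (Finset.mem_filter.2 ⟨hm, hgm⟩))
        ((lead_orbitMonomial m).of_coeff_ne_zero hne
          fun h => hml (weightSum_injective h).symm).2

/-! ### The invariant algebra -/

theorem mem_fixedAlg {f : GroupAlg} :
    f ∈ fixedAlg ↔ ∀ w ∈ weylGroup, ∀ u, f.coeff (w u) = f.coeff u := by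
  simp only [fixedAlg, Algebra.mem_iInf, AlgHom.mem_equalizer, AlgHom.id_apply]
  refine forall₂_congr fun w _ => ?_
  have key : ∀ u, (mapDomainAlgHom ℤ ℤ (w.toLinearEquiv.toAddEquiv : V →+ V) f).coeff (w u) =
      f.coeff u := fun u => Finsupp.mapDomain_apply w.injective f.coeff u
  constructor
  · intro h u
    rw [← key u, h]
  · intro h
    ext u
    obtain ⟨u, rfl⟩ := w.surjective u
    rw [key, h]

theorem mem_rootLatticeAlg {f : GroupAlg} :
    f ∈ rootLatticeAlg ↔ ∀ u, f.coeff u ≠ 0 → u ∈ rootLattice := by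
  classical
  constructor
  · rintro ⟨g, rfl⟩ u hu
    by_contra hc
    refine hu (Finsupp.mapDomain_of_notMem_range g.coeff u ?_)
    rintro ⟨v, rfl⟩
    exact hc v.2
  · intro h
    have e : f = ∑ u ∈ f.coeff.support, single u (f.coeff u) := by
      ext u
      simp [Finsupp.single_apply, Finsupp.finsetSum_apply]
    rw [e]
    refine sum_mem fun u hu => ⟨single ⟨u, h u (Finsupp.mem_support_iff.1 hu)⟩ (f.coeff u), ?_⟩
    simp

theorem orbitSum_mem_fixedAlg (v : V) : orbitSum v ∈ fixedAlg := by
  classical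
  rw [mem_fixedAlg]
  intro w hw u
  rw [coeff_orbitSum, coeff_orbitSum]
  congr 1
  apply propext
  constructor
  · rintro ⟨g, hg, h⟩
    exact ⟨w⁻¹ * g, mul_mem (inv_mem hw) hg, by
      rw [LinearIsometryEquiv.coe_mul, Function.comp_apply, h]
      exact w.symm_apply_apply u⟩
  · rintro ⟨g, hg, rfl⟩
    exact ⟨w * g, mul_mem hw hg, rfl⟩

theorem orbitMonomial_mem {l : Fin 6 → ℕ} (hl : l ∈ coordMonoid) :
    orbitMonomial l ∈ invariantAlg := by
  refine ⟨mem_rootLatticeAlg.2 fun u hu => ?_,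
    prod_mem fun i _ => pow_mem (orbitSum_mem_fixedAlg _) _⟩
  have h0 := weightSum_mem_rootLattice.2 hl
  by_cases h : u = weightSum l
  · rwa [h]
  · simpa using add_mem ((lead_orbitMonomial l).of_coeff_ne_zero hu h).1 h0

/-- A vector of maximal height in the support of an invariant is a dominant weight. -/
theorem exists_weightSum_of_maximal {f : GroupAlg} (hf : f ∈ invariantAlg) {u : V}
    (hu : f.coeff u ≠ 0) (hmax : ∀ v, f.coeff v ≠ 0 → height v ≤ height u) :
    ∃ l ∈ coordMonoid, weightSum l = u := by
  obtain ⟨n, hn, hn'⟩ := mem_rootLattice.1 (mem_rootLatticeAlg.1 hf.1 u hu)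
  have hnn : ∀ j, 0 ≤ n j := by
    intro j
    obtain ⟨s, hs, hs'⟩ := exists_simpleReflection j
    have h1 := hmax (s u) (by rwa [mem_fixedAlg.1 hf.2 s hs])
    rw [hs', map_sub, map_smul, height_simpleRoot, hn.2, smul_eq_mul, mul_one] at h1
    have : (0 : ℝ) ≤ n j := by linarith
    exact_mod_cast this
  have e : weightSum (fun j => (n j).toNat) = u := by
    have h := hasLabels_weightSum fun j => (n j).toNat
    simp only [Int.toNat_of_nonneg (hnn _)] at h
    rw [h.eq_sum, ← hn.eq_sum]
  refine ⟨_, ?_, e⟩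
  rw [← weightSum_mem_rootLattice, e]
  exact mem_rootLattice.2 ⟨n, hn, hn'⟩

theorem height_nonneg (l : Fin 6 → ℕ) : 0 ≤ height (weightSum l) := by
  rw [(hasLabels_weightSum l).height_eq, labelHeight]
  exact_mod_cast Nat.zero_le (8 * l 0 + 11 * l 1 + 15 * l 2 + 21 * l 3 + 15 * l 4 + 8 * l 5)

/-- Induction on a height bound: all terms of top height are removed at once by subtracting
monomials in the orbit sums. The process stops at 0 because dominant weights have nonnegative
height. -/
theorem mem_span_of_height_lt (n : ℕ) (f : GroupAlg) (hf : f ∈ invariantAlg)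
    (hn : ∀ u, f.coeff u ≠ 0 → height u < n) :
    f ∈ Submodule.span ℤ (orbitMonomial '' coordMonoid) := by
  classical
  induction n generalizing f with
  | zero =>
    suffices f = 0 by rw [this]; exact zero_mem _
    by_contra hne
    have hs : f.coeff.support.Nonempty := by
      rw [Finsupp.support_nonempty_iff]
      exact fun h => hne (coeff_eq_zero.1 h)
    obtain ⟨u, hu, hmax⟩ := f.coeff.support.exists_max_image height hs
    obtain ⟨l, -, rfl⟩ := exists_weightSum_of_maximal hf (Finsupp.mem_support_iff.1 hu)
      fun v hv => hmax v (Finsupp.mem_support_iff.2 hv)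
    have h1 := hn _ (Finsupp.mem_support_iff.1 hu)
    have h2 := height_nonneg l
    push_cast at h1
    linarith
  | succ n ih =>
    -- Heights of root lattice vectors are integers, so nothing lies strictly between `n` and `n +
    -- 1`.
    have hle : ∀ u, f.coeff u ≠ 0 → ¬ height u < n → height u = n := by
      intro u hu hlt
      obtain ⟨k, hk, -⟩ := mem_rootLattice.1 (mem_rootLatticeAlg.1 hf.1 u hu)
      have h1 := hn u hu
      rw [hk.height_eq] at h1 hlt ⊢
      have h2 : labelHeight k < n + 1 := by exact_mod_cast h1
      have h3 : ¬ labelHeight k < n := by exact_mod_cast hlt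
      have h4 : labelHeight k = n := by omega
      rw [h4]
      simp
    set T := f.coeff.support.filter fun u => ¬ height u < n with hT
    have hTl : ∀ u ∈ T, ∃ l ∈ coordMonoid, weightSum l = u := by
      intro u hu
      obtain ⟨h1, h2⟩ := Finset.mem_filter.1 hu
      rw [Finsupp.mem_support_iff] at h1
      refine exists_weightSum_of_maximal hf h1 fun v hv => ?_
      rw [hle u h1 h2]
      by_contra hlt
      exact hlt (hle v hv fun h => hlt h.le).le
    choose! l hl hlu using hTl
    have hg : ∑ u ∈ T, f.coeff u • orbitMonomial (l u) ∈
        Submodule.span ℤ (orbitMonomial '' coordMonoid) :=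
      sum_mem fun u hu => Submodule.smul_mem _ _ (Submodule.subset_span ⟨l u, hl u hu, rfl⟩)
    have hg' : ∑ u ∈ T, f.coeff u • orbitMonomial (l u) ∈ invariantAlg :=
      sum_mem fun u hu => Subalgebra.smul_mem _ (orbitMonomial_mem (hl u hu)) _
    have h := ih (f - ∑ u ∈ T, f.coeff u • orbitMonomial (l u)) (sub_mem hf hg') ?_
    · simpa using add_mem h hg
    · intro v hv
      by_contra hlt
      apply hv
      rw [coeff_sub, Finsupp.sub_apply, coeff_sum, Finsupp.finsetSum_apply]
      have key : ∀ u ∈ T, (f.coeff u • orbitMonomial (l u)).coeff v =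
          if u = v then f.coeff v else 0 := by
        intro u hu
        rw [coeff_smul_apply]
        split_ifs with huv
        · subst huv
          have := (lead_orbitMonomial (l u)).coeff_self
          rw [hlu u hu] at this
          rw [this, smul_eq_mul, mul_one]
        · suffices (orbitMonomial (l u)).coeff v = 0 by rw [this, smul_zero]
          by_contra hne
          have h1 := ((lead_orbitMonomial (l u)).of_coeff_ne_zero hne
            (by rw [hlu u hu]; exact Ne.symm huv)).2
          obtain ⟨h2, h3⟩ := Finset.mem_filter.1 hu
          rw [hlu u hu, hle u (Finsupp.mem_support_iff.1 h2) h3] at h1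
          exact hlt h1
      rw [Finset.sum_congr rfl key, Finset.sum_ite_eq' T v]
      split_ifs with hvT
      · exact sub_self _
      · rw [sub_zero]
        by_contra hne
        exact hvT (Finset.mem_filter.2 ⟨Finsupp.mem_support_iff.2 hne, hlt⟩)

theorem mem_invariantAlg {f : GroupAlg} :
    f ∈ invariantAlg ↔ f ∈ Submodule.span ℤ (orbitMonomial '' coordMonoid) := by
  constructor
  · intro hf
    obtain ⟨n, hn⟩ : ∃ n : ℕ, ∀ u, f.coeff u ≠ 0 → height u < n := by
      obtain ⟨c, hc⟩ := (f.coeff.support.image height).exists_le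
      obtain ⟨n, hn⟩ := exists_nat_gt c
      exact ⟨n, fun u hu => (hc _ (Finset.mem_image_of_mem _
        (Finsupp.mem_support_iff.2 hu))).trans_lt hn⟩
    exact mem_span_of_height_lt n f hf hn
  · intro hf
    refine Submodule.span_induction ?_ (zero_mem _) (fun _ _ _ _ => add_mem)
      (fun c _ _ h => Subalgebra.smul_mem _ h c) hf
    rintro _ ⟨l, hl, rfl⟩
    exact orbitMonomial_mem hl

/-! ### Presentations -/

/-- The kernel of a homomorphism that maps the monomials to elements of a linearly independent
family is generated by differences of monomials. -/
theorem ker_eq_of_linearIndependent {σ N A : Type*} [CommRing A] {β : N → A}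
    (hβ : LinearIndependent ℤ β) (d : (σ →₀ ℕ) → N) (φ : MvPolynomial σ ℤ →ₐ[ℤ] A)
    (hφ : ∀ s, φ (MvPolynomial.monomial s 1) = β (d s)) (I : Ideal (MvPolynomial σ ℤ))
    (hI : I ≤ RingHom.ker φ)
    (hd : ∀ s t, d s = d t → MvPolynomial.monomial s 1 - MvPolynomial.monomial t 1 ∈ I) :
    RingHom.ker φ = I := by
  classical
  refine le_antisymm (fun f hf => ?_) hI
  have hsum : f = ∑ s ∈ f.support, f.coeff s • MvPolynomial.monomial s (1 : ℤ) := by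
    conv_lhs => rw [f.as_sum]
    refine Finset.sum_congr rfl fun s _ => ?_
    rw [MvPolynomial.smul_monomial, smul_eq_mul, mul_one]
  -- `F` collects the coefficients of `f` by degree; independence of `β` makes each sum zero.
  set F : N →₀ ℤ := ∑ s ∈ f.support, Finsupp.single (d s) (f.coeff s) with hF
  have hF0 : F = 0 := by
    refine (linearIndependent_iff.1 hβ) F ?_
    rw [hF, map_sum]
    simp only [Finsupp.linearCombination_single]
    rw [RingHom.mem_ker, hsum, map_sum] at hf
    simpa only [map_smul, hφ] using hf
  -- One representative monomial is chosen in each degree. Replacing every monomial by its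
  -- representative changes `f` by an element of `I` and yields 0.
  set sec : N → (σ →₀ ℕ) := Function.invFun d with hsec
  have h0 : ∑ s ∈ f.support, f.coeff s • MvPolynomial.monomial (sec (d s)) (1 : ℤ) = 0 := by
    have h := congrArg
      (Finsupp.linearCombination ℤ fun n => MvPolynomial.monomial (sec n) (1 : ℤ)) hF0
    rw [hF, map_sum, map_zero] at h
    simpa only [Finsupp.linearCombination_single] using h
  have h1 : ∑ s ∈ f.support, f.coeff s • (MvPolynomial.monomial s (1 : ℤ) -
      MvPolynomial.monomial (sec (d s)) 1) ∈ I :=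
    sum_mem fun s _ => Submodule.smul_of_tower_mem I _
      (hd _ _ (Function.invFun_eq (f := d) (b := d s) ⟨s, rfl⟩).symm)
  simp only [smul_sub, Finset.sum_sub_distrib] at h1
  rwa [h0, sub_zero, ← hsum] at h1

theorem map_relations {R S : Type*} [CommRing R] [CommRing S] (f : R →+* S) (x : Fin 12 → R)
    (i : Fin 35) : f (relations x i) = relations (fun j => f (x j)) i := by
  fin_cases i <;> simp [relations]

theorem relations_prodInv (i : Fin 35) : relations prodInv i = 0 := by
  fin_cases i <;> simp [relations, prodInv, hilbW] <;> ring

theorem prod_pow_eq {R : Type*} [CommRing R] {x : Fin 12 → R} (h : relations x = 0)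
    (s t : Fin 12 → ℕ) (hst : ∑ j, s j • hilbW j = ∑ j, t j • hilbW j) :
    ∏ j, x j ^ s j = ∏ j, x j ^ t j := by
  have h1 : ∀ s : Fin 12 → ℕ, ((∑ j, s j • ({j} : Multiset (Fin 12))).map x).prod =
      ∏ j, x j ^ s j := by
    intro s
    rw [← Multiset.coe_mapAddMonoidHom, map_sum, Multiset.prod_sum]
    simp [Multiset.map_nsmul, Multiset.prod_nsmul]
  have h2 : ∀ s : Fin 12 → ℕ, multiDeg (∑ j, s j • ({j} : Multiset (Fin 12))) =
      ∑ j, s j • hilbW j := by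
    intro s
    rw [multiDeg, ← Multiset.coe_mapAddMonoidHom, map_sum, Multiset.sum_sum]
    simp only [Multiset.coe_mapAddMonoidHom, Multiset.map_nsmul, Multiset.sum_nsmul,
      Multiset.map_singleton, Multiset.sum_singleton]
  rw [← h1, ← h1]
  exact prod_eq_of_multiDeg_eq h _ _ (by rw [h2, h2, hst])

/-- The monomials in the six orbit sums, as a homomorphism. -/
noncomputable def orbitHom : Multiplicative (Fin 6 → ℕ) →* GroupAlg where
  toFun l := orbitMonomial l.toAdd
  map_one' := orbitMonomial_zero
  map_mul' l m := orbitMonomial_add l.toAdd m.toAdd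

theorem orbitMonomial_sum {σ : Type*} [Fintype σ] (c : σ → Fin 6 → ℕ) (s : σ → ℕ) :
    orbitMonomial (∑ i, s i • c i) = ∏ i, orbitMonomial (c i) ^ s i := by
  have h := map_prod orbitHom (fun i => Multiplicative.ofAdd (c i) ^ s i) Finset.univ
  simp only [map_pow] at h
  exact h

theorem aeval_monomial_one {σ : Type*} [Fintype σ] {x : σ → GroupAlg} (c : σ → Fin 6 → ℕ)
    (hx : ∀ i, x i = orbitMonomial (c i)) (s : σ →₀ ℕ) :
    MvPolynomial.aeval x (MvPolynomial.monomial s (1 : ℤ)) =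
      orbitMonomial (∑ i, s i • c i) := by
  rw [MvPolynomial.aeval_monomial, map_one, one_mul, orbitMonomial_sum,
    Finsupp.prod_fintype _ _ (fun i => pow_zero _)]
  simp only [hx]

theorem prodInv_eq (j : Fin 12) : prodInv j = orbitMonomial (insertCoords 0 0 (hilbW j)) := by
  simp [prodInv, orbitMonomial, Fin.prod_univ_six, insertCoords]

theorem fundInv_eq (i : Fin 2 ⊕ Fin 12) : fundInv i = orbitMonomial (hilbCoord i) := by
  rcases i with i | j
  · fin_cases i <;>
    simp [fundInv, freeInv, hilbCoord, orbitMonomial, Fin.prod_univ_six]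
  · exact prodInv_eq j

theorem sum_insertCoords (s : Fin 12 → ℕ) :
    ∑ j, s j • insertCoords 0 0 (hilbW j) = insertCoords 0 0 (∑ j, s j • hilbW j) := by
  ext i
  fin_cases i <;> simp [insertCoords, Finset.sum_apply]

theorem insertCoords_injective {a b a' b' : ℕ} {k k' : Fin 4 → ℕ}
    (h : insertCoords a b k = insertCoords a' b' k') : a = a' ∧ b = b' ∧ k = k' := by
  have h0 := congrFun h 0
  have h1 := congrFun h 1
  have h2 := congrFun h 2
  have h3 := congrFun h 3
  have h4 := congrFun h 4
  have h5 := congrFun h 5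
  refine ⟨h1, h3, funext fun i => ?_⟩
  fin_cases i
  exacts [h0, h2, h4, h5]

theorem sum_hilbCoord (s : Fin 2 ⊕ Fin 12 → ℕ) :
    ∑ i, s i • hilbCoord i =
      insertCoords (s (Sum.inl 0)) (s (Sum.inl 1)) (∑ j, s (Sum.inr j) • hilbW j) := by
  have h : ∑ i, s i • hilbCoord i = s (Sum.inl 0) • Pi.single 1 1 + s (Sum.inl 1) • Pi.single 3 1 +
      ∑ j, s (Sum.inr j) • insertCoords 0 0 (hilbW j) := by
    rw [Fintype.sum_sum_type, Fin.sum_univ_two]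
    rfl
  rw [h, sum_insertCoords]
  ext i
  fin_cases i <;> simp [insertCoords]

/-- This makes `prod_pow_eq` available in the quotient ring, where equality of two monomials means
that their difference lies in the ideal. -/
theorem relations_mk {σ : Type*} (f : Fin 12 → σ) :
    relations (fun j => Ideal.Quotient.mk
      (Ideal.span (Set.range (relations fun j => (MvPolynomial.X (f j) : MvPolynomial σ ℤ))))
      (MvPolynomial.X (f j))) = 0 := by
  ext i
  rw [← map_relations]
  exact Ideal.Quotient.eq_zero_iff_mem.2 (Ideal.subset_span ⟨i, rfl⟩)

theorem span_relations_le_ker {σ A : Type*} [CommRing A] {x : σ → A} (f : Fin 12 → σ)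
    (h : relations (fun j => x (f j)) = 0) :
    Ideal.span (Set.range (relations fun j => (MvPolynomial.X (f j) : MvPolynomial σ ℤ))) ≤
      RingHom.ker (MvPolynomial.aeval x : MvPolynomial σ ℤ →ₐ[ℤ] A) := by
  rw [Ideal.span_le]
  rintro _ ⟨i, rfl⟩
  have := map_relations (MvPolynomial.aeval x : MvPolynomial σ ℤ →ₐ[ℤ] A).toRingHom
    (fun j => (MvPolynomial.X (f j) : MvPolynomial σ ℤ)) i
  refine this.trans ?_
  simpa using congrFun h i

theorem mk_monomial {σ : Type*} [Fintype σ] (I : Ideal (MvPolynomial σ ℤ)) (s : σ →₀ ℕ) :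
    Ideal.Quotient.mk I (MvPolynomial.monomial s 1) =
      ∏ i, Ideal.Quotient.mk I (MvPolynomial.X i) ^ s i := by
  rw [MvPolynomial.monomial_eq, map_one, one_mul, Finsupp.prod_fintype _ _ (fun i => pow_zero _),
    map_prod]
  simp only [map_pow]

theorem ker_aeval_prodInv :
    RingHom.ker (MvPolynomial.aeval prodInv : MvPolynomial (Fin 12) ℤ →ₐ[ℤ] GroupAlg) =
      Ideal.span (Set.range (relations (fun j => MvPolynomial.X j))) := by
  refine ker_eq_of_linearIndependent linearIndependent_orbitMonomial _ _
    (aeval_monomial_one _ prodInv_eq) _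
    (span_relations_le_ker id (funext relations_prodInv)) fun s t hst => ?_
  rw [sum_insertCoords, sum_insertCoords] at hst
  rw [← Ideal.Quotient.eq, mk_monomial, mk_monomial]
  exact prod_pow_eq (relations_mk id) _ _ (insertCoords_injective hst).2.2

/-- The exponents of t₁ and t₂ can be read off from coordinates 1 and 3 of the degree, so these
variables contribute no new relations. -/
theorem ker_aeval_fundInv :
    RingHom.ker (MvPolynomial.aeval fundInv :
        MvPolynomial (Fin 2 ⊕ Fin 12) ℤ →ₐ[ℤ] GroupAlg) =
      Ideal.span (Set.range (relations (fun j => MvPolynomial.X (Sum.inr j)))) := by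
  refine ker_eq_of_linearIndependent linearIndependent_orbitMonomial _ _
    (aeval_monomial_one _ fundInv_eq) _
    (span_relations_le_ker Sum.inr (funext relations_prodInv)) fun s t hst => ?_
  rw [sum_hilbCoord, sum_hilbCoord] at hst
  obtain ⟨h0, h1, h2⟩ := insertCoords_injective hst
  rw [← Ideal.Quotient.eq, mk_monomial, mk_monomial, Fintype.prod_sum_type, Fintype.prod_sum_type,
    Fin.prod_univ_two, Fin.prod_univ_two, h0, h1]
  congr 1
  exact prod_pow_eq (relations_mk Sum.inr) _ _ h2

/-! ### The structure of the invariant algebra -/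

theorem adjoin_fundInv : Algebra.adjoin ℤ (Set.range fundInv) = invariantAlg := by
  refine le_antisymm (Algebra.adjoin_le ?_) fun f hf => ?_
  · rintro _ ⟨i, rfl⟩
    rw [fundInv_eq]
    refine orbitMonomial_mem ?_
    rw [← isHilbertBasis_coordMonoid.closure_eq]
    exact AddSubmonoid.subset_closure ⟨i, rfl⟩
  · rw [mem_invariantAlg] at hf
    refine Submodule.span_induction ?_ (zero_mem _) (fun _ _ _ _ => add_mem)
      (fun c _ _ h => Subalgebra.smul_mem _ h c) hf
    rintro _ ⟨l, hl, rfl⟩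
    rw [SetLike.mem_coe, ← isHilbertBasis_coordMonoid.closure_eq] at hl
    induction hl using AddSubmonoid.closure_induction with
    | mem _ h =>
      obtain ⟨i, rfl⟩ := h
      rw [← fundInv_eq]
      exact Algebra.subset_adjoin ⟨i, rfl⟩
    | zero => rw [orbitMonomial_zero]; exact one_mem _
    | add l m _ _ h1 h2 => rw [orbitMonomial_add]; exact mul_mem h1 h2

/-- Here the degree map is injective on monomials, so the kernel is generated by nothing. -/
theorem algebraicIndependent_orbitSum :
    AlgebraicIndependent ℤ fun i : Fin 6 => orbitSum (weight i) := by
  have h := ker_eq_of_linearIndependent linearIndependent_orbitMonomial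
    (fun s : Fin 6 →₀ ℕ => (s : Fin 6 → ℕ))
    (MvPolynomial.aeval fun i : Fin 6 => orbitSum (weight i)) (fun s => ?_) ⊥ bot_le
    (fun s t hst => by
      rw [DFunLike.coe_injective hst, sub_self]
      exact zero_mem _)
  · exact (RingHom.injective_iff_ker_eq_bot _).2 h
  · rw [MvPolynomial.aeval_monomial, map_one, one_mul,
      Finsupp.prod_fintype _ _ (fun i => pow_zero _)]
    rfl

theorem algebraicIndependent_of_le {R A ι : Type*} [CommRing R] [CommRing A] [Algebra R A]
    {S T : Subalgebra R A} (h : S ≤ T) {x : ι → A} (hx : AlgebraicIndependent T x) :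
    AlgebraicIndependent S x := by
  let _ : Algebra S T := (Subalgebra.inclusion h).toAlgebra
  have : IsScalarTower S T A := .of_algebraMap_eq fun x => rfl
  exact hx.restrictScalars (Subalgebra.inclusion_injective h)

/-- The six orbit sums are algebraically independent, so O(ϖ₂), O(ϖ₄) are independent over the
algebra of the other four, which contains all the products in `prodInv`. -/
theorem algebraicIndependent_freeInv :
    AlgebraicIndependent (Algebra.adjoin ℤ (Set.range prodInv)) freeInv := by
  have h := algebraicIndependent_orbitSum.adjoin_of_disjoint (s := {0, 2, 4, 5}) (t := {1, 3})
    (by simp)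
  have h' := h.comp ![⟨1, by simp⟩, ⟨3, by simp⟩] (by
    intro i j hij
    fin_cases i <;> fin_cases j <;> simp_all)
  have hle : Algebra.adjoin ℤ (Set.range prodInv) ≤
      Algebra.adjoin ℤ ((fun i : Fin 6 => orbitSum (weight i)) '' {0, 2, 4, 5}) := by
    refine Algebra.adjoin_le ?_
    rintro _ ⟨j, rfl⟩
    have hm : ∀ i ∈ ({0, 2, 4, 5} : Set (Fin 6)), orbitSum (weight i) ∈
        Algebra.adjoin ℤ ((fun i : Fin 6 => orbitSum (weight i)) '' {0, 2, 4, 5}) :=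
      fun i hi => Algebra.subset_adjoin ⟨i, hi, rfl⟩
    exact mul_mem (mul_mem (mul_mem (pow_mem (hm 0 (by simp)) _) (pow_mem (hm 2 (by simp)) _))
      (pow_mem (hm 4 (by simp)) _)) (pow_mem (hm 5 (by simp)) _)
  have h2 := algebraicIndependent_of_le hle h'
  convert h2 using 1
  ext1 i
  fin_cases i <;> rfl

/-- The homomorphism from the monoid algebra of `M` that sends `∑ l_i ϖ_i` to
`∏ O(ϖ_i) ^ l_i`. -/
noncomputable def monoidAlgHom : AddMonoidAlgebra ℤ M →ₐ[ℤ] GroupAlg :=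
  AddMonoidAlgebra.lift ℤ GroupAlg M
    { toFun := fun m => orbitMonomial (coordEquiv.symm m.toAdd)
      map_one' := by
        rw [toAdd_one, map_zero]
        exact orbitMonomial_zero
      map_mul' := fun m m' => by
        rw [toAdd_mul, map_add]
        exact orbitMonomial_add _ _ }

theorem monoidAlgHom_single (m : M) (c : ℤ) :
    monoidAlgHom (single m c) = c • orbitMonomial (coordEquiv.symm m) :=
  AddMonoidAlgebra.lift_single _ _ _

/-- The basis of the monoid algebra goes, without repetition, to members of a linearly independent
family. -/
theorem monoidAlgHom_injective : Function.Injective monoidAlgHom := by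
  rw [injective_iff_map_eq_zero]
  intro f hf
  have h := linearIndependent_orbitMonomial.comp (fun m : M => (coordEquiv.symm m : Fin 6 → ℕ))
    (Subtype.val_injective.comp coordEquiv.symm.injective)
  rw [← coeff_eq_zero]
  refine linearIndependent_iff.1 h _ ?_
  rw [← hf, monoidAlgHom, AddMonoidAlgebra.lift_apply]
  rfl

theorem range_monoidAlgHom : monoidAlgHom.range = invariantAlg := by
  apply le_antisymm
  · rintro _ ⟨f, rfl⟩
    change monoidAlgHom f ∈ invariantAlg
    rw [monoidAlgHom, AddMonoidAlgebra.lift_apply]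
    exact sum_mem fun m _ =>
      Subalgebra.smul_mem _ (orbitMonomial_mem (coordEquiv.symm m).2) _
  · intro f hf
    rw [mem_invariantAlg] at hf
    refine Submodule.span_induction ?_ (zero_mem _) (fun _ _ _ _ => add_mem)
      (fun c _ _ h => Subalgebra.smul_mem _ h c) hf
    rintro _ ⟨l, hl, rfl⟩
    refine ⟨single (coordEquiv ⟨l, hl⟩) 1, ?_⟩
    change monoidAlgHom _ = _
    rw [monoidAlgHom_single, AddEquiv.symm_apply_apply, one_smul]

theorem hilbM_eq (i : Fin 2 ⊕ Fin 12) : hilbM i = weightSum (hilbCoord i) := by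
  rcases i with i | j
  · fin_cases i <;> simp [hilbM, hilbCoord, weightSum_apply, Fin.sum_univ_six]
  · rfl

theorem hilbM_eq_comp : hilbM = weightSum ∘ hilbCoord := funext hilbM_eq

theorem isHilbertBasis_M : IsHilbertBasis M (Set.range hilbM) := by
  have h := isHilbertBasis_coordMonoid.map weightSum weightSum_injective
  rwa [map_weightSum, ← Set.range_comp, ← hilbM_eq_comp] at h

/-- The isomorphism `((a, b), k) ↦ (k₁, a, k₂, b, k₃, k₄)`. -/
def insertEquiv : (ℕ × ℕ) × W ≃+ coordMonoid where
  toFun p := ⟨insertCoords p.1.1 p.1.2 p.2.1, p.2.2⟩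
  invFun l := ((l.1 1, l.1 3), ⟨![l.1 0, l.1 2, l.1 4, l.1 5], l.2⟩)
  left_inv := by
    rintro ⟨⟨a, b⟩, k, hk⟩
    refine Prod.ext rfl (Subtype.ext (funext fun i => ?_))
    fin_cases i <;> rfl
  right_inv := by
    rintro ⟨l, hl⟩
    refine Subtype.ext (funext fun i => ?_)
    fin_cases i <;> rfl
  map_add' := by
    rintro ⟨⟨a, b⟩, k, hk⟩ ⟨⟨a', b'⟩, k', hk'⟩
    refine Subtype.ext (funext fun i => ?_)
    fin_cases i <;> rfl

end RootE6

theorem mainTheorem3 :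
    -- the Weyl group is finite, and the `ϖ_i` are the fundamental weights
    Finite RootE6.weylGroup ∧
    (∀ i, RootE6.weight i ∈ RootE6.E) ∧
    (∀ i j, RootE6.bracket (RootE6.weight i) (RootE6.simpleRoot j) = if i = j then 1 else 0) ∧
    -- the isomorphism of the monoid algebra of `M` with the invariant algebra
    (∃ Ω : AddMonoidAlgebra ℤ RootE6.M ≃ₐ[ℤ] RootE6.invariantAlg,
      ∀ (l : Fin 6 → ℕ) (hl : ∑ i, l i • RootE6.weight i ∈ RootE6.M),
        (Ω (AddMonoidAlgebra.single (⟨∑ i, l i • RootE6.weight i, hl⟩ : RootE6.M) (1 : ℤ)) :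
          RootE6.GroupAlg) = ∏ i, RootE6.orbitSum (RootE6.weight i) ^ l i) ∧
    -- the description of `M` by a congruence
    (∃ f : RootE6.coordMonoid ≃+ RootE6.M,
      ∀ l : RootE6.coordMonoid, (f l : RootE6.V) = ∑ i, l.1 i • RootE6.weight i) ∧
    -- the decomposition as `ℕ² ⊕ W`
    (∃ g : (ℕ × ℕ) × RootE6.W ≃+ RootE6.coordMonoid,
      ∀ (a b : ℕ) (k : RootE6.W),
        (g ((a, b), k) : Fin 6 → ℕ) = RootE6.insertCoords a b k.1) ∧
    -- the Hilbert bases of `W` and of `M`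
    Function.Injective RootE6.hilbW ∧
    RootE6.IsHilbertBasis RootE6.W (Set.range RootE6.hilbW) ∧
    Function.Injective RootE6.hilbM ∧
    RootE6.IsHilbertBasis RootE6.M (Set.range RootE6.hilbM) ∧
    -- the fundamental invariants generate the invariant algebra
    Algebra.adjoin ℤ (Set.range RootE6.fundInv) = RootE6.invariantAlg ∧
    -- the first two are algebraically independent over the algebra of the other twelve
    AlgebraicIndependent (Algebra.adjoin ℤ (Set.range RootE6.prodInv)) RootE6.freeInv ∧
    -- the relations between the twelve products of orbit sums
    RingHom.ker (MvPolynomial.aeval RootE6.prodInv :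
        MvPolynomial (Fin 12) ℤ →ₐ[ℤ] RootE6.GroupAlg) =
      Ideal.span (Set.range (RootE6.relations (fun j => MvPolynomial.X j))) ∧
    -- the presentation of the invariant algebra
    RingHom.ker (MvPolynomial.aeval RootE6.fundInv :
        MvPolynomial (Fin 2 ⊕ Fin 12) ℤ →ₐ[ℤ] RootE6.GroupAlg) =
      Ideal.span (Set.range (RootE6.relations (fun j => MvPolynomial.X (Sum.inr j)))) := by
  refine ⟨RootE6.finite_weylGroup, RootE6.weight_mem_E, RootE6.bracket_weight_simpleRoot,
    ⟨(AlgEquiv.ofInjective _ RootE6.monoidAlgHom_injective).trans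
      (Subalgebra.equivOfEq _ _ RootE6.range_monoidAlgHom), fun l hl => ?_⟩,
    ⟨RootE6.coordEquiv, fun l => rfl⟩, ⟨RootE6.insertEquiv, fun a b k => rfl⟩,
    RootE6.hilbW_injective, RootE6.isHilbertBasis_W,
    RootE6.hilbM_eq_comp ▸ RootE6.weightSum_injective.comp RootE6.hilbCoord_injective,
    RootE6.isHilbertBasis_M, RootE6.adjoin_fundInv, RootE6.algebraicIndependent_freeInv,
    RootE6.ker_aeval_prodInv, RootE6.ker_aeval_fundInv⟩
  have hl' : l ∈ RootE6.coordMonoid := RootE6.weightSum_mem_rootLattice.1 hl.2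
  have e : RootE6.coordEquiv.symm ⟨∑ i, l i • RootE6.weight i, hl⟩ = ⟨l, hl'⟩ := by
    rw [AddEquiv.symm_apply_eq]
    rfl
  change RootE6.monoidAlgHom (AddMonoidAlgebra.single _ 1) = _
  rw [RootE6.monoidAlgHom_single, e, one_smul]
  rfl
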